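/- Let $\Gamma$ be a metric graph, i.e. a finite non-empty connected multigraph (loops, multiple edges and vertices of degree two are allowed) in which every edge $e$ has a positive finite length and is identified with a closed interval of that length. Its vertices are called branching points, and their set is denoted $B(\Gamma)$. A divisor is an element $D=\sum_p D(p)(p)$ of the free abelian group on the points of $\Gamma$; put $\deg D=\sum_p D(p)$ and $\deg^+ D=\sum_p \max\{0,D(p)\}$. A rational function is a continuous function $f:\Gamma\to\mathbb R$ that on every edge is piecewise linear with finitely many pieces and integral slopes; $\mathrm{ord}_f(p)$ is the sum of the outgoing slopes of $f$ at $p$ and $D_f=\sum_p \mathrm{ord}_f(p)(p)$. Divisors $D,D'$ are equivalent, $D\sim D'$, if $D=D'+D_f$ for some rational function $f$; $|D|$ is the set of effective divisors equivalent to $D$, and the rank of $D$ is $$r(D)=\min\{\deg E-1 : E\ge 0,\ |D-E|=\emptyset\}.$$ Fix a loop transversal $I$ of $\Gamma$, i.e. a set consisting of exactly one interior point of every loop. Let $\mathcal P(\Gamma)$ be the set of permutations of points of $\Gamma$ with respect to $I$, i.e. finite sequences $P$ of distinct points of $\Gamma$ whose set of points $\mathrm{supp}\,P$ contains $B(\Gamma)\cup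 I$. For $P\in\mathcal P(\Gamma)$, a $P$-segment is a non-degenerate closed subinterval of an edge whose ends belong to $\mathrm{supp}\,P$ and whose interior contains no point of $\mathrm{supp}\,P$; for $v\in\mathrm{supp}\,P$ let $S_P(v)$ be the set of $P$-segments with one end at $v$ and the other end preceding $v$ in $P$, and let $$\nu_P=\sum_{v\in\mathrm{supp}\,P}(|S_P(v)|-1)(v).$$ Then, for every divisor $D$ on $\Gamma$, the minimum defining $r(D)$ exists, and $$r(D)=\min_{\substack{D'\sim D\\ P\in\mathcal P(\Gamma)}}\deg^+(D'-\nu_P)-1,$$ where this minimum is attained as well. -/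

import Mathlib

open Set

noncomputable section

/-- A metric graph: a connected nonempty multigraph (loops and multiple edges allowed) with vertex
set `V` and edge set `E`, each edge having a positive length. The choice of which end of an edge is
`src` and which is `tgt` only serves to parametrize the edge by `[0, len e]`. Finiteness of `V` and
`E` is required separately, through type class binders. Vertices of degree two are allowed. -/
structure MetricGraph (V : Type*) (E : Type*) where
  src : E → V
  tgt : E → V
  len : E → ℝ
  len_pos : ∀ e, 0 < len e
  nonempty : Nonempty V
  connected : ∀ u v : V, Relation.EqvGen (fun a b => ∃ e, src e = a ∧ tgt e = b) u v

namespace MetricGraph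

universe u v

variable {V : Type u} {E : Type v}

/-- The points of the metric graph: the vertices, and the points of the open edges. -/
inductive Point (G : MetricGraph V E) : Type (max u v)
  | vertex (a : V) : Point G
  | interior (e : E) (t : ℝ) (pos : 0 < t) (lt : t < G.len e) : Point G

/-- The parametrization of the edge `e` by `[0, len e]`, with the ends of the interval sent to the
end vertices (extended to all of `ℝ` by constants). -/
def pt (G : MetricGraph V E) (e : E) (t : ℝ) : G.Point :=
  if h₀ : 0 < t then
    if h₁ : t < G.len e then .interior e t h₀ h₁ else .vertex (G.tgt e)
  else .vertex (G.src e)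

/-- The topology of the geometric realization: the quotient topology of the disjoint union of the
vertices and the closed intervals `[0, len e]`. -/
instance (G : MetricGraph V E) : TopologicalSpace G.Point :=
  ⨆ e : E, TopologicalSpace.coinduced (fun t : Icc (0 : ℝ) (G.len e) => G.pt e t) inferInstance

/-- The branching points of the metric graph: its vertices. -/
def branching (G : MetricGraph V E) : Set G.Point := range Point.vertex

/-! ### Divisors -/

/-- A divisor: an element of the free abelian group on the points. -/
abbrev Divisor (G : MetricGraph V E) : Type (max u v) := G.Point →₀ ℤ

/-- The degree of a divisor. -/
def deg {G : MetricGraph V E} (D : G.Divisor) : ℤ := D.sum fun _ n => n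

/-- The sum of the positive coefficients of a divisor. -/
def degPos {G : MetricGraph V E} (D : G.Divisor) : ℤ := D.sum fun _ n => max 0 n

/-! ### Rational functions and linear equivalence -/

/-- `h` is piecewise linear with finitely many pieces and integral slopes on `[0, L]`. -/
def IsPiecewiseLinear (L : ℝ) (h : ℝ → ℝ) : Prop :=
  ∃ (n : ℕ) (t : ℕ → ℝ) (s : ℕ → ℤ), t 0 = 0 ∧ t n = L ∧ (∀ i < n, t i < t (i + 1)) ∧
    ∀ i < n, ∀ x ∈ Icc (t i) (t (i + 1)), h x = h (t i) + s i * (x - t i)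

/-- A rational function: a continuous real function on the metric graph which on every edge is
piecewise linear with finitely many pieces and integral slopes. -/
def IsRational (G : MetricGraph V E) (f : G.Point → ℝ) : Prop :=
  Continuous f ∧ ∀ e, IsPiecewiseLinear (G.len e) fun t => f (G.pt e t)

/-- The slope of `f` at the point of parameter `t < len e` of `e`, in the direction of increasing
parameters. -/
def slopeUp (G : MetricGraph V E) (f : G.Point → ℝ) (e : E) (t : ℝ) : ℝ :=
  derivWithin (fun x => f (G.pt e x)) (Ici t) t

/-- The slope of `f` at the point of parameter `t > 0` of `e`, in the direction of decreasing
parameters. -/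
def slopeDown (G : MetricGraph V E) (f : G.Point → ℝ) (e : E) (t : ℝ) : ℝ :=
  -derivWithin (fun x => f (G.pt e x)) (Iic t) t

open Classical in
/-- The order of `f` at a point: the sum of the outgoing slopes of `f` along all segments emanating
from the point. A loop contributes two outgoing slopes at its vertex. -/
def ord (G : MetricGraph V E) [Fintype E] (f : G.Point → ℝ) : G.Point → ℝ
  | .vertex a =>
      ∑ e : E, ((if G.src e = a then G.slopeUp f e 0 else 0) +
        (if G.tgt e = a then G.slopeDown f e (G.len e) else 0))
  | .interior e t _ _ => G.slopeUp f e t + G.slopeDown f e t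

/-- Linear equivalence of divisors: `D = D' + D_f` for a rational function `f`, where `D_f` is the
divisor with `D_f p = ord_f p`. -/
def LinEquiv {G : MetricGraph V E} [Fintype E] (D D' : G.Divisor) : Prop :=
  ∃ f : G.Point → ℝ, G.IsRational f ∧ ∀ p, (D p : ℝ) = D' p + G.ord f p

/-- The complete linear system `|D|`. -/
def linearSystem {G : MetricGraph V E} [Fintype E] (D : G.Divisor) : Set G.Divisor :=
  {F | 0 ≤ F ∧ LinEquiv F D}

/-- The numbers `deg F - 1` for the effective divisors `F` with `|D - F| = ∅`. -/
def rankSet {G : MetricGraph V E} [Fintype E] (D : G.Divisor) : Set ℤ :=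
  {n | ∃ F : G.Divisor, 0 ≤ F ∧ linearSystem (D - F) = ∅ ∧ n = deg F - 1}

/-- The rank of a divisor: the minimum of `rankSet D`. -/
def rank {G : MetricGraph V E} [Fintype E] (D : G.Divisor) : ℤ := sInf (rankSet D)

/-! ### Permutations of points -/

/-- A loop transversal: a set consisting of exactly one interior point of every loop. -/
def IsLoopTransversal (G : MetricGraph V E) (I : Set G.Point) : Prop :=
  ∃ t : E → ℝ, (∀ e, G.src e = G.tgt e → t e ∈ Ioo 0 (G.len e)) ∧
    I = {p | ∃ e, G.src e = G.tgt e ∧ p = G.pt e (t e)}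

/-- `P` is a permutation of points of `G` with respect to `I`: a finite sequence of distinct points
containing all branching points and all points of `I`. -/
def IsPermutation (G : MetricGraph V E) (I : Set G.Point) (P : List G.Point) : Prop :=
  P.Nodup ∧ G.branching ∪ I ⊆ {p | p ∈ P}

/-- A (nondegenerate) segment of the metric graph: a subinterval `[lo, hi]` of an edge. -/
structure Segment (G : MetricGraph V E) where
  edge : E
  lo : ℝ
  hi : ℝ
  lo_nonneg : 0 ≤ lo
  lo_lt_hi : lo < hi
  hi_le : hi ≤ G.len edge

/-- A `P`-segment: both ends belong to `P`, and the interior contains no point of `P`. -/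
def IsPSegment {G : MetricGraph V E} (P : List G.Point) (S : G.Segment) : Prop :=
  G.pt S.edge S.lo ∈ P ∧ G.pt S.edge S.hi ∈ P ∧ ∀ x ∈ Ioo S.lo S.hi, G.pt S.edge x ∉ P

open Classical in
/-- `p` precedes `q` in the linear order defined by `P` (for `p` and `q` in `P`). -/
def Precedes {G : MetricGraph V E} (P : List G.Point) (p q : G.Point) : Prop :=
  P.idxOf p < P.idxOf q

/-- The `P`-segments with one end at `p` and the other end preceding `p`. -/
def segmentsBelow {G : MetricGraph V E} (P : List G.Point) (p : G.Point) : Set G.Segment :=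
  {S | IsPSegment P S ∧
    ((G.pt S.edge S.lo = p ∧ Precedes P (G.pt S.edge S.hi) p) ∨
      (G.pt S.edge S.hi = p ∧ Precedes P (G.pt S.edge S.lo) p))}

open Classical in
/-- The divisor `ν_P`, the sum over the points `p` of `P` of `(|S_P(p)| - 1) (p)`. -/
def nu {G : MetricGraph V E} (P : List G.Point) : G.Divisor :=
  ∑ p ∈ P.toFinset, Finsupp.single p (((segmentsBelow P p).ncard : ℤ) - 1)

end MetricGraph

end

noncomputable section

namespace MetricGraph

open Filter Topology

variable {V E : Type*} {G : MetricGraph V E}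

/-! ### Oriented edges -/

/-! Two facts about the divisors `nu P` carry the theorem.

(1) No divisor dominated by `nu P` is equivalent to an effective one (`exists_nu_add_ordInt_neg`,
`linearSystem_eq_empty`). Suppose `nu P + D_f ≥ 0`. Off `P` the function `f` has nonnegative orders,
so it is convex along `P`-segments and attains its maximum at a point of `P`. Let `v` be the first
such point in `P`. All slopes at `v` are at most 0. Towards a preceding point the slope is at most
-1: otherwise convexity would make that point maximal too. Hence `ord_f v ≤ -|S_P(v)|`, and the
coefficient of `nu P + D_f` at `v` is at most -1. For `D' ~ D`, the positive part `F` of `D' - nu P`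
satisfies `D' - F ≤ nu P`, so `|D - F|` is empty and `r(D) ≤ degPos (D' - nu P) - 1`.

(2) Conversely, if `|C|` is empty, then some `C' ~ C` is dominated by some `nu P`
(`exists_equiv_le_nu`). Among the divisors equivalent to `C` take `C₀` with the least total debt,
and a point `p₀` in debt. Let `h` be the largest rational function with `h p₀ = 0` and poles bounded
by the positive part of `C₀`, and put `C' = C₀ + D_h`. The debt cannot have dropped, so `p₀` is
still in debt. Start Dhar's fire at all points in debt: a point burns when it has fewer chips than
burnt directions. If the fire stopped, the unburnt points could be fired together, which would give
an admissible function exceeding `h` (`exists_equiv_burning`). So every finite set containing the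
vertices and the points in debt burns, and the order of burning is a permutation `P` with `C' ≤ nu
P`. Applied to `C = D - F` with `F` realizing the rank, the divisor `D' = C' + F` attains the
minimum.

The analytic core is the existence of `h` (`exists_largest_admissible`). Slopes of admissible
functions are bounded by the degree of the pole bound, so the pointwise supremum is finite. Along a
segment without poles these functions are convex with integral slopes from a finite set, so their
supremum is a maximum of finitely many integral affine functions and is again rational. -/

/-- The oriented edge with the opposite orientation. -/
def flip (d : E × Bool) : E × Bool := (d.1, !d.2)

@[simp] lemma flip_fst (d : E × Bool) : (flip d).1 = d.1 := rfl

@[simp] lemma flip_flip (d : E × Bool) : flip (flip d) = d := by simp [flip]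

lemma flip_ne (d : E × Bool) : flip d ≠ d := by
  intro h
  have := congrArg Prod.snd h
  simp [flip] at this

variable (G) in
/-- The parametrization of the oriented edge `d` by `[0, len]`. -/
def arc (d : E × Bool) (s : ℝ) : G.Point := G.pt d.1 (if d.2 then s else G.len d.1 - s)

lemma arc_true (e : E) (s : ℝ) : G.arc (e, true) s = G.pt e s := rfl

lemma arc_false (e : E) (s : ℝ) : G.arc (e, false) s = G.pt e (G.len e - s) := rfl

lemma arc_flip (d : E × Bool) (s : ℝ) : G.arc (flip d) s = G.arc d (G.len d.1 - s) := by
  rcases d with ⟨e, _ | _⟩ <;> simp [flip, arc]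

lemma pt_interior {e : E} {t : ℝ} (h₀ : 0 < t) (h₁ : t < G.len e) :
    G.pt e t = .interior e t h₀ h₁ := by simp [pt, h₀, h₁]

lemma pt_of_nonpos (e : E) {t : ℝ} (h : t ≤ 0) : G.pt e t = .vertex (G.src e) := by
  simp [pt, not_lt.mpr h]

lemma pt_of_len_le (e : E) {t : ℝ} (h : G.len e ≤ t) : G.pt e t = .vertex (G.tgt e) := by
  simp [pt, not_lt.mpr h, (G.len_pos e).trans_le h]

@[simp] lemma pt_zero (e : E) : G.pt e 0 = .vertex (G.src e) := pt_of_nonpos e le_rfl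

@[simp] lemma pt_len (e : E) : G.pt e (G.len e) = .vertex (G.tgt e) := pt_of_len_le e le_rfl

lemma pt_eq_interior {e e' : E} {t s : ℝ} {h₀ : 0 < s} {h₁ : s < G.len e'} :
    G.pt e t = .interior e' s h₀ h₁ ↔ e = e' ∧ t = s := by
  by_cases h : 0 < t
  · by_cases h' : t < G.len e
    · simp [pt_interior h h']
    · simp only [pt_of_len_le e (not_lt.mp h'), reduceCtorEq, false_iff, not_and]
      rintro rfl rfl; exact h' h₁
  · simp only [pt_of_nonpos e (not_lt.mp h), reduceCtorEq, false_iff, not_and]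
    rintro rfl rfl; exact h h₀

lemma arc_mem_branching_left (d : E × Bool) : G.arc d 0 ∈ G.branching := by
  rcases d with ⟨e, _ | _⟩ <;> simp [arc, branching]

lemma arc_mem_branching_right (d : E × Bool) : G.arc d (G.len d.1) ∈ G.branching := by
  rcases d with ⟨e, _ | _⟩ <;> simp [arc, branching]

lemma arc_inj_Ioo {d : E × Bool} {s t : ℝ} (hs : s ∈ Ioo 0 (G.len d.1))
    (h : G.arc d t = G.arc d s) : t = s := by
  rcases d with ⟨e, _ | _⟩
  · rw [arc_false, arc_false,
      pt_interior (t := G.len e - s) (by simpa using hs.2) (by simpa using hs.1),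
      pt_eq_interior] at h
    linarith [h.2]
  · rw [arc_true, arc_true, pt_interior hs.1 hs.2, pt_eq_interior] at h
    exact h.2

/-- The parameter of a point on an oriented edge emanating from it. -/
def coord : G.Point → E × Bool → ℝ
  -- An oriented edge emanating from a vertex starts there, so its parameter is 0; this also covers
  -- both orientations of a loop.
  | .vertex _, _ => 0
  | .interior e t _ _, d => if d.2 then t else G.len e - t

lemma coord_arc {d : E × Bool} {s : ℝ} (hs : s ∈ Ico 0 (G.len d.1)) :
    coord (G.arc d s) d = s := by
  rcases hs.1.eq_or_lt with rfl | h0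
  · obtain ⟨a, ha⟩ := arc_mem_branching_left (G := G) d
    rw [← ha]; rfl
  · rcases d with ⟨e, _ | _⟩
    · rw [arc_false, pt_interior (by simpa using hs.2) (by simpa using h0)]; simp [coord]
    · rw [arc_true, pt_interior h0 hs.2]; simp [coord]

/-! ### Directions at a point -/

section Tangents

variable [Fintype E]

open Classical in
/-- The oriented edges emanating from a point. -/
def tangents (p : G.Point) : Finset (E × Bool) :=
  -- The interval is half-open so that an oriented edge counts at its beginning and not at its end:
  -- a loop gives two directions at its vertex, an edge gives two at each interior point.
  Finset.univ.filter fun d => ∃ s ∈ Ico 0 (G.len d.1), G.arc d s = p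

lemma mem_tangents {p : G.Point} {d : E × Bool} :
    d ∈ tangents p ↔ ∃ s ∈ Ico 0 (G.len d.1), G.arc d s = p := by simp [tangents]

lemma arc_mem_tangents {d : E × Bool} {s : ℝ} (hs : s ∈ Ico 0 (G.len d.1)) :
    d ∈ tangents (G.arc d s) := mem_tangents.2 ⟨s, hs, rfl⟩

lemma coord_mem {p : G.Point} {d : E × Bool} (h : d ∈ tangents p) :
    coord p d ∈ Ico 0 (G.len d.1) := by
  obtain ⟨s, hs, rfl⟩ := mem_tangents.1 h
  rwa [coord_arc hs]

lemma arc_coord {p : G.Point} {d : E × Bool} (h : d ∈ tangents p) :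
    G.arc d (coord p d) = p := by
  obtain ⟨s, hs, rfl⟩ := mem_tangents.1 h
  rw [coord_arc hs]

lemma mem_tangents_vertex {a : V} {d : E × Bool} :
    d ∈ tangents (Point.vertex a : G.Point) ↔ (if d.2 then G.src d.1 else G.tgt d.1) = a := by
  have h0 : G.arc d 0 = .vertex (if d.2 then G.src d.1 else G.tgt d.1) := by
    rcases d with ⟨e, _ | _⟩ <;> simp [arc]
  constructor
  · intro h
    have h1 := arc_coord h
    simp only [coord] at h1
    rw [h0] at h1
    simpa using h1
  · rintro rfl
    rw [← h0]
    exact arc_mem_tangents ⟨le_rfl, G.len_pos _⟩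

open Classical in
lemma tangents_arc {d : E × Bool} {s : ℝ} (hs : s ∈ Ioo 0 (G.len d.1)) :
    tangents (G.arc d s) = {d, flip d} := by
  ext d'
  rw [mem_tangents, Finset.mem_insert, Finset.mem_singleton]
  constructor
  · rintro ⟨t, -, ht'⟩
    have : d'.1 = d.1 := by
      rcases d with ⟨e, _ | _⟩
      · rw [arc_false, pt_interior (by simpa using hs.2) (by simpa using hs.1), arc,
          pt_eq_interior] at ht'
        exact ht'.1
      · rw [arc_true, pt_interior hs.1 hs.2, arc, pt_eq_interior] at ht'
        exact ht'.1
    rcases d with ⟨e, _ | _⟩ <;> rcases d' with ⟨e', _ | _⟩ <;> simp_all [flip]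
  · rintro (rfl | rfl)
    · exact ⟨s, ⟨hs.1.le, hs.2⟩, rfl⟩
    · refine ⟨G.len d.1 - s, ⟨by linarith [hs.2], by simpa using hs.1⟩, ?_⟩
      rw [arc_flip, sub_sub_cancel]

end Tangents

/-- Every point that is not a vertex lies inside an edge. -/
lemma exists_arc_of_notMem_branching {p : G.Point} (h : p ∉ G.branching) :
    ∃ d : E × Bool, ∃ s ∈ Ioo 0 (G.len d.1), G.arc d s = p := by
  cases p with
  | vertex a => exact absurd ⟨a, rfl⟩ h
  | interior e t h₀ h₁ => exact ⟨(e, true), t, ⟨h₀, h₁⟩, pt_interior h₀ h₁⟩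

/-! ### Slopes -/

/-- The function `f` is linear with slope `k` to the right of the parameter `s` of the oriented
edge `d`. -/
def HasSlope (f : G.Point → ℝ) (d : E × Bool) (s : ℝ) (k : ℤ) : Prop :=
  ∀ᶠ u in 𝓝[>] s, f (G.arc d u) = f (G.arc d s) + k * (u - s)

lemma HasSlope.unique {f : G.Point → ℝ} {d : E × Bool} {s : ℝ} {k l : ℤ}
    (hk : HasSlope f d s k) (hl : HasSlope f d s l) : k = l := by
  obtain ⟨u, ⟨h1, h2⟩, h3⟩ := ((hk.and hl).and self_mem_nhdsWithin).exists
  have h4 : (0 : ℝ) < u - s := sub_pos.2 h3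
  have : ((k : ℝ) - l) * (u - s) = 0 := by linarith
  rcases mul_eq_zero.1 this with h | h
  · exact_mod_cast sub_eq_zero.1 h
  · exact absurd h h4.ne'

lemma HasSlope.add {f g : G.Point → ℝ} {d : E × Bool} {s : ℝ} {k l : ℤ}
    (hk : HasSlope f d s k) (hl : HasSlope g d s l) : HasSlope (f + g) d s (k + l) := by
  filter_upwards [hk, hl] with u h1 h2
  simp only [Pi.add_apply, h1, h2]; push_cast; ring

lemma HasSlope.neg {f : G.Point → ℝ} {d : E × Bool} {s : ℝ} {k : ℤ}
    (hk : HasSlope f d s k) : HasSlope (-f) d s (-k) := by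
  filter_upwards [hk] with u h1
  simp only [Pi.neg_apply, h1]; push_cast; ring

lemma hasSlope_const (c : ℝ) (d : E × Bool) (s : ℝ) :
    HasSlope (fun _ : G.Point => c) d s 0 := by
  filter_upwards with u
  simp

lemma HasSlope.tendsto {f : G.Point → ℝ} {d : E × Bool} {s : ℝ} {k : ℤ}
    (hk : HasSlope f d s k) :
    Tendsto (fun u => f (G.arc d u)) (𝓝[>] s) (𝓝 (f (G.arc d s))) := by
  have : Tendsto (fun u : ℝ => f (G.arc d s) + k * (u - s)) (𝓝[>] s) (𝓝 (f (G.arc d s))) := by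
    have h : Continuous fun u : ℝ => f (G.arc d s) + k * (u - s) := by fun_prop
    simpa using (h.tendsto s).mono_left nhdsWithin_le_nhds
  exact this.congr' (hk.mono fun u hu => hu.symm)

/-- The maximum of two functions with slopes has a slope, not smaller than that of a function
attaining the maximum. -/
lemma HasSlope.sup {f g : G.Point → ℝ} {d : E × Bool} {s : ℝ} {k l : ℤ}
    (hk : HasSlope f d s k) (hl : HasSlope g d s l) :
    HasSlope (f ⊔ g) d s (if g (G.arc d s) < f (G.arc d s) then k else
      if f (G.arc d s) < g (G.arc d s) then l else max k l) := by
  split_ifs with h1 h2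
  · filter_upwards [hk, hl.tendsto.eventually_lt hk.tendsto h1] with u hu h
    simp only [Pi.sup_apply]
    rw [sup_eq_left.2 h.le, sup_eq_left.2 h1.le, hu]
  · filter_upwards [hl, hk.tendsto.eventually_lt hl.tendsto h2] with u hu h
    simp only [Pi.sup_apply]
    rw [sup_eq_right.2 h.le, sup_eq_right.2 h2.le, hu]
  · have h : f (G.arc d s) = g (G.arc d s) := le_antisymm (not_lt.1 h1) (not_lt.1 h2)
    filter_upwards [hk, hl, self_mem_nhdsWithin] with u h1 h2 h3
    have h4 : (0 : ℝ) < u - s := sub_pos.2 h3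
    simp only [Pi.sup_apply, h1, h2, h, sup_idem]
    rw [← add_sup]
    push_cast
    rw [max_mul_of_nonneg _ _ h4.le]

lemma hasSlope_true {f : G.Point → ℝ} {e : E} {t : ℝ} {k : ℤ} :
    HasSlope f (e, true) t k ↔ ∀ᶠ u in 𝓝[>] t, f (G.pt e u) = f (G.pt e t) + k * (u - t) :=
  Iff.rfl

lemma hasSlope_false {f : G.Point → ℝ} {e : E} {t : ℝ} {k : ℤ} :
    HasSlope f (e, false) (G.len e - t) k ↔
      ∀ᶠ u in 𝓝[<] t, f (G.pt e u) = f (G.pt e t) + k * (t - u) := by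
  constructor
  · intro h
    have ht : Tendsto (fun u => G.len e - u) (𝓝[<] t) (𝓝[>] (G.len e - t)) := by
      refine tendsto_nhdsWithin_of_tendsto_nhds_of_eventually_within _ ?_ ?_
      · exact ((continuous_const.sub continuous_id).tendsto t).mono_left nhdsWithin_le_nhds
      · filter_upwards [self_mem_nhdsWithin] with u hu
        simpa using hu
    filter_upwards [ht.eventually h] with u hu
    simp only [arc_false, sub_sub_cancel] at hu
    rw [hu]; ring
  · intro h
    have ht : Tendsto (fun u => G.len e - u) (𝓝[>] (G.len e - t)) (𝓝[<] t) := by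
      refine tendsto_nhdsWithin_of_tendsto_nhds_of_eventually_within _ ?_ ?_
      · have := ((continuous_const (y := G.len e)).sub continuous_id).tendsto (G.len e - t)
        simp only [id, Pi.sub_apply, sub_sub_cancel] at this
        exact this.mono_left nhdsWithin_le_nhds
      · filter_upwards [self_mem_nhdsWithin] with u hu
        have : G.len e - t < u := hu
        simp only [mem_Iio]; linarith
    filter_upwards [ht.eventually h] with u hu
    simp only [arc_false, sub_sub_cancel]
    rw [hu]; ring

lemma HasSlope.hasDerivWithinAt {f : G.Point → ℝ} {d : E × Bool} {s : ℝ} {k : ℤ}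
    (h : HasSlope f d s k) : HasDerivWithinAt (fun u => f (G.arc d u)) k (Ici s) s := by
  have h1 : HasDerivWithinAt (fun u => f (G.arc d s) + (k : ℝ) * (u - s)) k (Ici s) s := by
    have := (((hasDerivAt_id s).sub_const s).const_mul (k : ℝ)).const_add (f (G.arc d s))
    simpa using this.hasDerivWithinAt
  rw [← hasDerivWithinAt_Ioi_iff_Ici] at h1 ⊢
  exact h1.congr_of_eventuallyEq h (by simp)

lemma slopeUp_eq {f : G.Point → ℝ} {e : E} {t : ℝ} {k : ℤ} (h : HasSlope f (e, true) t k) :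
    G.slopeUp f e t = k :=
  h.hasDerivWithinAt.derivWithin (uniqueDiffWithinAt_Ici t)

lemma slopeDown_eq {f : G.Point → ℝ} {e : E} {t : ℝ} {k : ℤ}
    (h : HasSlope f (e, false) (G.len e - t) k) : G.slopeDown f e t = k := by
  rw [hasSlope_false] at h
  have h1 : HasDerivWithinAt (fun u => f (G.pt e t) + (k : ℝ) * (t - u)) (-k) (Iic t) t := by
    have := (((hasDerivAt_id t).const_sub t).const_mul (k : ℝ)).const_add (f (G.pt e t))
    simpa using this.hasDerivWithinAt
  have h2 : HasDerivWithinAt (fun u => f (G.pt e u)) (-k) (Iic t) t := by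
    rw [← hasDerivWithinAt_Iio_iff_Iic] at h1 ⊢
    exact h1.congr_of_eventuallyEq h (by simp)
  rw [slopeDown, h2.derivWithin (uniqueDiffWithinAt_Iic t), neg_neg]

/-- All slopes of `f` exist and are integers. -/
def HasSlopes (f : G.Point → ℝ) : Prop :=
  ∀ d : E × Bool, ∀ s ∈ Ico 0 (G.len d.1), ∃ k : ℤ, HasSlope f d s k

open Classical in
/-- The slope of `f` to the right of the parameter `s` of the oriented edge `d`. -/
def slp (f : G.Point → ℝ) (d : E × Bool) (s : ℝ) : ℤ :=
  if h : ∃ k : ℤ, HasSlope f d s k then h.choose else 0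

lemma HasSlope.slp_eq {f : G.Point → ℝ} {d : E × Bool} {s : ℝ} {k : ℤ} (h : HasSlope f d s k) :
    slp f d s = k := by
  have h' : ∃ k : ℤ, HasSlope f d s k := ⟨k, h⟩
  rw [slp, dif_pos h']
  exact h'.choose_spec.unique h

lemma HasSlopes.hasSlope {f : G.Point → ℝ} (hf : HasSlopes f) {d : E × Bool} {s : ℝ}
    (hs : s ∈ Ico 0 (G.len d.1)) : HasSlope f d s (slp f d s) := by
  obtain ⟨k, hk⟩ := hf d s hs
  rwa [hk.slp_eq]

lemma HasSlopes.add {f g : G.Point → ℝ} (hf : HasSlopes f) (hg : HasSlopes g) :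
    HasSlopes (f + g) := fun _ _ hs => ⟨_, (hf.hasSlope hs).add (hg.hasSlope hs)⟩

lemma HasSlopes.neg {f : G.Point → ℝ} (hf : HasSlopes f) : HasSlopes (-f) :=
  fun _ _ hs => ⟨_, (hf.hasSlope hs).neg⟩

lemma HasSlopes.sup {f g : G.Point → ℝ} (hf : HasSlopes f) (hg : HasSlopes g) :
    HasSlopes (f ⊔ g) := fun _ _ hs => ⟨_, (hf.hasSlope hs).sup (hg.hasSlope hs)⟩

lemma hasSlopes_const (c : ℝ) : HasSlopes (fun _ : G.Point => c) :=
  fun _ _ _ => ⟨_, hasSlope_const c _ _⟩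

/-! ### Orders as sums of integral slopes over directions -/

section Order

variable [Fintype E]

/-- The order of a function as a sum over the oriented edges emanating from a point. -/
def ordInt (f : G.Point → ℝ) (p : G.Point) : ℤ := ∑ d ∈ tangents p, slp f d (coord p d)

lemma ordInt_arc (f : G.Point → ℝ) {d : E × Bool} {s : ℝ} (hs : s ∈ Ioo 0 (G.len d.1)) :
    ordInt f (G.arc d s) = slp f d s + slp f (flip d) (G.len d.1 - s) := by
  classical
  have h : G.arc d s = G.arc (flip d) (G.len d.1 - s) := by rw [arc_flip, sub_sub_cancel]
  rw [ordInt, tangents_arc hs, Finset.sum_pair (flip_ne d).symm, coord_arc ⟨hs.1.le, hs.2⟩]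
  congr 1
  rw [h, coord_arc ⟨by simpa using hs.2.le, by simpa using hs.1⟩]

lemma HasSlopes.ord_eq {f : G.Point → ℝ} (hf : HasSlopes f) (p : G.Point) :
    G.ord f p = ordInt f p := by
  classical
  have hup : ∀ e, ∀ t ∈ Ico 0 (G.len e), G.slopeUp f e t = slp f (e, true) t :=
    fun e t ht => slopeUp_eq (hf.hasSlope (d := (e, true)) ht)
  have hdown : ∀ e, ∀ t ∈ Ioc 0 (G.len e),
      G.slopeDown f e t = slp f (e, false) (G.len e - t) :=
    fun e t ht => slopeDown_eq (hf.hasSlope (d := (e, false)) ⟨by simpa using ht.2, by simpa using ht.1⟩)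
  cases p with
  | vertex a =>
    have : (tangents (Point.vertex a : G.Point)) =
        Finset.univ.filter fun d : E × Bool => (if d.2 then G.src d.1 else G.tgt d.1) = a := by
      ext d; rw [mem_tangents_vertex]; simp
    rw [ordInt, this, Finset.sum_filter, Fintype.sum_prod_type, ord]
    push_cast
    refine Finset.sum_congr rfl fun e _ => ?_
    rw [hup e 0 ⟨le_rfl, G.len_pos e⟩, hdown e _ ⟨G.len_pos e, le_rfl⟩]
    simp [coord]
  | interior e t h₀ h₁ =>
    have h : G.arc (e, true) t = .interior e t h₀ h₁ := pt_interior h₀ h₁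
    rw [← h, ordInt_arc f ⟨h₀, h₁⟩, h, ord, hup e t ⟨h₀.le, h₁⟩, hdown e t ⟨h₀, h₁.le⟩]
    push_cast; rfl

lemma ordInt_add {f g : G.Point → ℝ} (hf : HasSlopes f) (hg : HasSlopes g) (p : G.Point) :
    ordInt (f + g) p = ordInt f p + ordInt g p := by
  rw [ordInt, ordInt, ordInt, ← Finset.sum_add_distrib]
  refine Finset.sum_congr rfl fun d hd => ?_
  exact ((hf.hasSlope (coord_mem hd)).add (hg.hasSlope (coord_mem hd))).slp_eq

lemma ordInt_neg {f : G.Point → ℝ} (hf : HasSlopes f) (p : G.Point) :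
    ordInt (-f) p = -ordInt f p := by
  rw [ordInt, ordInt, ← Finset.sum_neg_distrib]
  exact Finset.sum_congr rfl fun d hd => ((hf.hasSlope (coord_mem hd)).neg).slp_eq

lemma ordInt_const (c : ℝ) (p : G.Point) : ordInt (fun _ : G.Point => c) p = 0 :=
  Finset.sum_eq_zero fun _ _ => (hasSlope_const c _ _).slp_eq

end Order

end MetricGraph

namespace MetricGraph

open Filter Topology

variable {V E : Type*} {G : MetricGraph V E}

/-! ### Rational functions have integral slopes, and conversely -/

lemma exists_mem_Ico_of_partition {t : ℕ → ℝ} {n : ℕ} {x : ℝ} (h₀ : t 0 ≤ x) (hn : x < t n) :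
    ∃ i < n, t i ≤ x ∧ x < t (i + 1) := by
  induction n with
  | zero => exact absurd hn (not_lt.2 h₀)
  | succ n ih =>
    by_cases h : x < t n
    · obtain ⟨i, hi, h⟩ := ih h
      exact ⟨i, by omega, h⟩
    · exact ⟨n, by omega, not_lt.1 h, hn⟩

lemma exists_mem_Ioc_of_partition {t : ℕ → ℝ} {n : ℕ} {x : ℝ} (h₀ : t 0 < x) (hn : x ≤ t n) :
    ∃ i < n, t i < x ∧ x ≤ t (i + 1) := by
  induction n with
  | zero => exact absurd h₀ (not_lt.2 hn)
  | succ n ih =>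
    by_cases h : x ≤ t n
    · obtain ⟨i, hi, h⟩ := ih h
      exact ⟨i, by omega, h⟩
    · exact ⟨n, by omega, not_le.1 h, hn⟩

lemma partition_le {t : ℕ → ℝ} {n : ℕ} (ht : ∀ i < n, t i < t (i + 1)) {i j : ℕ} (hij : i ≤ j)
    (hj : j ≤ n) : t i ≤ t j := by
  induction j, hij using Nat.le_induction with
  | base => exact le_rfl
  | succ j _ ih => exact (ih (by omega)).trans (ht j (by omega)).le

lemma hasSlope_true_of_linear {f : G.Point → ℝ} {e : E} {a b x : ℝ} {k : ℤ}
    (h : ∀ u ∈ Icc a b, f (G.pt e u) = f (G.pt e a) + k * (u - a)) (ha : a ≤ x) (hb : x < b) :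
    HasSlope f (e, true) x k := by
  rw [hasSlope_true]
  filter_upwards [Ioo_mem_nhdsGT hb] with u hu
  rw [h u ⟨ha.trans hu.1.le, hu.2.le⟩, h x ⟨ha, hb.le⟩]; ring

lemma hasSlope_false_of_linear {f : G.Point → ℝ} {e : E} {a b x : ℝ} {k : ℤ}
    (h : ∀ u ∈ Icc a b, f (G.pt e u) = f (G.pt e a) + k * (u - a)) (ha : a < x) (hb : x ≤ b) :
    HasSlope f (e, false) (G.len e - x) (-k) := by
  rw [hasSlope_false]
  filter_upwards [Ioo_mem_nhdsLT ha] with u hu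
  rw [h u ⟨hu.1.le, hu.2.le.trans hb⟩, h x ⟨ha.le, hb⟩]; push_cast; ring

lemma IsRational.hasSlopes {f : G.Point → ℝ} (hf : G.IsRational f) : HasSlopes f := by
  rintro ⟨e, b⟩ s hs
  obtain ⟨n, t, k, h0, hn, -, h⟩ := hf.2 e
  rcases b with _ | _
  · have hs' : 0 ≤ s ∧ s < G.len e := hs
    obtain ⟨i, hi, h1, h2⟩ := exists_mem_Ioc_of_partition (t := t) (n := n) (x := G.len e - s)
      (by rw [h0]; linarith) (by rw [hn]; linarith)
    refine ⟨-k i, ?_⟩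
    have := hasSlope_false_of_linear (h i hi) h1 h2
    rwa [sub_sub_cancel] at this
  · obtain ⟨i, hi, h1, h2⟩ := exists_mem_Ico_of_partition (t := t) (n := n) (x := s)
      (by rw [h0]; exact hs.1) (by rw [hn]; exact hs.2)
    exact ⟨k i, hasSlope_true_of_linear (h i hi) h1 h2⟩

lemma IsPiecewiseLinear.extend {h : ℝ → ℝ} {y z : ℝ} {k : ℤ} (hy : IsPiecewiseLinear y h)
    (hyz : y < z) (hk : ∀ x ∈ Icc y z, h x = h y + k * (x - y)) : IsPiecewiseLinear z h := by
  obtain ⟨n, t, s, h0, hn, hlt, hlin⟩ := hy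
  refine ⟨n + 1, fun i => if i ≤ n then t i else z, fun i => if i < n then s i else k,
    by simp [h0], by simp, fun i hi => ?_, fun i hi => ?_⟩
  · rcases Nat.lt_succ_iff_lt_or_eq.1 hi with hi' | rfl
    · simpa [hi'.le, Nat.succ_le_of_lt hi'] using hlt i hi'
    · simpa [hn] using hyz
  · rcases Nat.lt_succ_iff_lt_or_eq.1 hi with hi' | rfl
    · simpa [hi'.le, Nat.succ_le_of_lt hi', hi'] using hlin i hi'
    · simpa [hn] using hk

/-- A function which is linear with integral slopes on both sides of every point is piecewise
linear with finitely many pieces. -/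
lemma isPiecewiseLinear_of_local {L : ℝ} (hL : 0 < L) {h : ℝ → ℝ}
    (hr : ∀ x ∈ Ico 0 L, ∃ k : ℤ, ∀ᶠ u in 𝓝[>] x, h u = h x + k * (u - x))
    (hl : ∀ x ∈ Ioc 0 L, ∃ k : ℤ, ∀ᶠ u in 𝓝[<] x, h u = h x + k * (x - u)) :
    IsPiecewiseLinear L h := by
  -- Continuous induction: linearity on the left shows that the supremum of `S` lies in `S`,
  -- linearity on the right that it cannot be less than `L`.
  set S : Set ℝ := {x | x ∈ Icc 0 L ∧ IsPiecewiseLinear x h} with hS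
  have h0 : (0 : ℝ) ∈ S := by
    refine ⟨⟨le_rfl, hL.le⟩, 0, fun _ => 0, fun _ => 0, rfl, rfl, ?_, ?_⟩ <;> simp
  have hbdd : BddAbove S := ⟨L, fun x hx => hx.1.2⟩
  set T := sSup S with hT
  have hT0 : 0 ≤ T := le_csSup hbdd h0
  have hTL : T ≤ L := csSup_le ⟨0, h0⟩ fun x hx => hx.1.2
  have hTS : T ∈ S := by
    rcases hT0.eq_or_lt with h | hpos
    · rwa [← h]
    obtain ⟨k, hk⟩ := hl T ⟨hpos, hTL⟩
    obtain ⟨a, ha, hak⟩ := (mem_nhdsLT_iff_exists_Ioo_subset (a := T)).1 hk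
    obtain ⟨y, hyS, hay⟩ := exists_lt_of_lt_csSup ⟨0, h0⟩ (show a < sSup S from ha)
    rcases (le_csSup hbdd hyS).eq_or_lt with h | hyT
    · rw [← hT] at h; rwa [← h]
    refine ⟨⟨hT0, hTL⟩, hyS.2.extend (k := -k) hyT fun x hx => ?_⟩
    have key : ∀ x ∈ Icc y T, h x = h T + k * (T - x) := by
      intro x hx
      rcases hx.2.eq_or_lt with rfl | h
      · simp
      · exact hak ⟨hay.trans_le hx.1, h⟩
    rw [key x hx, key y ⟨le_rfl, hyT.le⟩]; push_cast; ring
  rcases hTL.eq_or_lt with h | hlt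
  · rw [← h]; exact hTS.2
  obtain ⟨k, hk⟩ := hr T ⟨hT0, hlt⟩
  obtain ⟨b, hb, hbk⟩ := (mem_nhdsGT_iff_exists_Ioo_subset (a := T)).1
    (inter_mem hk (Ioo_mem_nhdsGT hlt))
  have hb : T < b := hb
  have hm : (T + b) / 2 ∈ S := by
    refine ⟨⟨by linarith, ?_⟩, hTS.2.extend (k := k) (by linarith) fun x hx => ?_⟩
    · exact (hbk (show (T + b) / 2 ∈ Ioo T b from ⟨by linarith, by linarith⟩)).2.2.le
    · rcases hx.1.eq_or_lt with rfl | h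
      · simp
      · exact (hbk ⟨h, by linarith [hx.2]⟩).1
  linarith [le_csSup hbdd hm]

/-- A slope gives continuity to the right; continuity to the left is the same statement for the
reversed edge. -/
lemma HasSlopes.continuousOn {f : G.Point → ℝ} (hf : HasSlopes f) (d : E × Bool) :
    ContinuousOn (fun u => f (G.arc d u)) (Icc 0 (G.len d.1)) := by
  have hright : ∀ d : E × Bool, ∀ x ∈ Ico 0 (G.len d.1),
      ContinuousWithinAt (fun u => f (G.arc d u)) (Ici x) x := by
    intro d x hx
    rw [← continuousWithinAt_Ioi_iff_Ici]
    exact (hf.hasSlope hx).tendsto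
  intro x hx
  have h1 : ContinuousWithinAt (fun u => f (G.arc d u)) (Icc x (G.len d.1)) x := by
    rcases hx.2.eq_or_lt with rfl | h
    · rw [Icc_self]; exact continuousWithinAt_singleton
    · exact (hright d x ⟨hx.1, h⟩).mono Icc_subset_Ici_self
  have h2 : ContinuousWithinAt (fun u => f (G.arc d u)) (Icc 0 x) x := by
    rcases hx.1.eq_or_lt with rfl | h
    · rw [Icc_self]; exact continuousWithinAt_singleton
    · have h3 := hright (flip d) (G.len d.1 - x) ⟨by simpa using hx.2, by simpa using h⟩
      have h4 : ContinuousWithinAt (fun u => f (G.arc (flip d) (G.len d.1 - u))) (Icc 0 x) x :=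
        h3.comp (f := fun u => G.len d.1 - u) (continuous_const.sub continuous_id).continuousWithinAt
          fun u hu => sub_le_sub_left hu.2 _
      simpa only [arc_flip, sub_sub_cancel] using h4
  rw [← Icc_union_Icc_eq_Icc hx.1 hx.2]
  exact h2.union h1

/-- The topology is coinduced from the closed edges, so continuity may be tested edge by edge.
Finiteness of the number of pieces comes from `isPiecewiseLinear_of_local`. -/
lemma HasSlopes.isRational {f : G.Point → ℝ} (hf : HasSlopes f) : G.IsRational f := by
  refine ⟨continuous_iSup_dom.2 fun e => continuous_coinduced_dom.2 ?_, fun e => ?_⟩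
  · exact continuousOn_iff_continuous_domRestrict.1 (hf.continuousOn (e, true))
  · refine isPiecewiseLinear_of_local (G.len_pos e) (fun x hx => hf (e, true) x hx)
      fun x hx => ?_
    obtain ⟨k, hk⟩ := hf (e, false) (G.len e - x) ⟨by simpa using hx.2, by simpa using hx.1⟩
    exact ⟨k, hasSlope_false.1 hk⟩

lemma isRational_iff {f : G.Point → ℝ} : G.IsRational f ↔ HasSlopes f :=
  ⟨IsRational.hasSlopes, HasSlopes.isRational⟩

/-! ### Degrees -/

variable (G) in
/-- The degree as a homomorphism. -/
def degHom : G.Divisor →+ ℤ := Finsupp.liftAddHom fun _ => AddMonoidHom.id ℤ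

lemma degHom_apply (D : G.Divisor) : degHom G D = deg D := rfl

lemma deg_add (D D' : G.Divisor) : deg (D + D') = deg D + deg D' := (degHom G).map_add D D'

lemma deg_sub (D D' : G.Divisor) : deg (D - D') = deg D - deg D' := (degHom G).map_sub D D'

lemma deg_single (p : G.Point) (n : ℤ) : deg (Finsupp.single p n) = n := by
  simp [deg]

lemma deg_nonneg {D : G.Divisor} (h : 0 ≤ D) : 0 ≤ deg D :=
  Finset.sum_nonneg fun p _ => h p

lemma deg_mono {D D' : G.Divisor} (h : D ≤ D') : deg D ≤ deg D' := by
  have := deg_nonneg (sub_nonneg.2 h)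
  rw [deg_sub] at this
  linarith

lemma le_deg {D : G.Divisor} (h : 0 ≤ D) (p : G.Point) : D p ≤ deg D := by
  classical
  have : Finsupp.single p (D p) ≤ D := by
    intro q
    rw [Finsupp.single_apply]
    split_ifs with hq
    · rw [hq]
    · exact h q
  have := deg_mono this
  rwa [deg_single] at this

/-- The positive part of a divisor. -/
def posPart (D : G.Divisor) : G.Divisor := D.mapRange (max 0) (by simp)

@[simp] lemma posPart_apply (D : G.Divisor) (p : G.Point) : posPart D p = max 0 (D p) := rfl

lemma posPart_nonneg (D : G.Divisor) : 0 ≤ posPart D := fun p => by simp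

lemma deg_posPart (D : G.Divisor) : deg (posPart D) = degPos D :=
  Finsupp.sum_mapRange_index (by simp)

/-! ### Principal divisors -/

variable [Fintype E]

/-- The orders of a rational function are the coefficients of a divisor of degree zero. -/
lemma HasSlopes.exists_divisor {f : G.Point → ℝ} (hf : HasSlopes f) :
    ∃ F : G.Divisor, (∀ p, F p = ordInt f p) ∧ deg F = 0 := by
  classical
  choose n t k h0 hn hlt hlin using (isRational_iff.2 hf).2
  have hle : ∀ e, ∀ {i j}, i ≤ j → j ≤ n e → t e i ≤ t e j := fun e _ _ => partition_le (hlt e)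
  -- Each slope is written as a sum over all pieces, of which only the one adjacent to `x` on the
  -- relevant side contributes. Orders can then be compared with the divisor below piece by piece.
  have hup : ∀ e, ∀ x ∈ Ico 0 (G.len e), slp f (e, true) x =
      ∑ i ∈ Finset.range (n e), if t e i ≤ x ∧ x < t e (i + 1) then k e i else 0 := by
    intro e x hx
    obtain ⟨i, hi, h1, h2⟩ := exists_mem_Ico_of_partition (t := t e) (n := n e) (x := x)
      (by rw [h0]; exact hx.1) (by rw [hn]; exact hx.2)
    rw [(hasSlope_true_of_linear (hlin e i hi) h1 h2).slp_eq, Finset.sum_eq_single i]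
    · rw [if_pos ⟨h1, h2⟩]
    · intro j hj hij
      rw [Finset.mem_range] at hj
      refine if_neg fun ⟨h3, h4⟩ => ?_
      rcases hij.lt_or_gt with h | h
      · linarith [hle e (show j + 1 ≤ i from h) hi.le]
      · linarith [hle e (show i + 1 ≤ j from h) hj.le]
    · intro h; exact absurd (Finset.mem_range.2 hi) h
  have hdown : ∀ e, ∀ x ∈ Ioc 0 (G.len e), slp f (e, false) (G.len e - x) =
      -∑ i ∈ Finset.range (n e), if t e i < x ∧ x ≤ t e (i + 1) then k e i else 0 := by
    intro e x hx
    obtain ⟨i, hi, h1, h2⟩ := exists_mem_Ioc_of_partition (t := t e) (n := n e) (x := x)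
      (by rw [h0]; exact hx.1) (by rw [hn]; exact hx.2)
    rw [(hasSlope_false_of_linear (hlin e i hi) h1 h2).slp_eq, Finset.sum_eq_single i]
    · rw [if_pos ⟨h1, h2⟩]
    · intro j hj hij
      rw [Finset.mem_range] at hj
      refine if_neg fun ⟨h3, h4⟩ => ?_
      rcases hij.lt_or_gt with h | h
      · linarith [hle e (show j + 1 ≤ i from h) hi.le]
      · linarith [hle e (show i + 1 ≤ j from h) hj.le]
    · intro h; exact absurd (Finset.mem_range.2 hi) h
  have hnonneg : ∀ e, ∀ i < n e, 0 ≤ t e i := fun e i hi => by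
    rw [← h0 e]; exact hle e (Nat.zero_le _) hi.le
  have hlen : ∀ e, ∀ i < n e, t e (i + 1) ≤ G.len e := fun e i hi => by
    rw [← hn e]; exact hle e hi le_rfl
  -- A linear piece of slope `k` contributes `k` at its left end and `-k` at its right end; at
  -- breaks inside an edge this gives the change of slope, and the degree is visibly 0.
  refine ⟨∑ e, ∑ i ∈ Finset.range (n e), k e i • (Finsupp.single (G.pt e (t e i)) (1 : ℤ) -
    Finsupp.single (G.pt e (t e (i + 1))) 1), fun p => ?_, ?_⟩
  · simp only [Finsupp.finsetSum_apply, Finsupp.smul_apply, Finsupp.sub_apply,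
      Finsupp.single_apply, smul_eq_mul]
    cases p with
    | vertex a =>
      have : (tangents (Point.vertex a : G.Point)) =
          Finset.univ.filter fun d : E × Bool => (if d.2 then G.src d.1 else G.tgt d.1) = a := by
        ext d; rw [mem_tangents_vertex]; simp
      rw [ordInt, this, Finset.sum_filter, Fintype.sum_prod_type]
      refine Finset.sum_congr rfl fun e _ => ?_
      have hL := G.len_pos e
      have h1 := hup e 0 ⟨le_rfl, hL⟩
      have h2 := hdown e (G.len e) ⟨hL, le_rfl⟩
      rw [sub_self] at h2
      simp only [Fintype.sum_bool, coord, if_true, Bool.false_eq_true, if_false, h1, h2]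
      have h3 : ∀ (q : Prop) [Decidable q] (g : ℕ → ℤ),
          (if q then ∑ i ∈ Finset.range (n e), g i else 0) =
            ∑ i ∈ Finset.range (n e), if q then g i else 0 := by
        intro q _ g; split_ifs <;> simp
      rw [← Finset.sum_neg_distrib, h3, h3, ← Finset.sum_add_distrib]
      refine Finset.sum_congr rfl fun i hi => ?_
      rw [Finset.mem_range] at hi
      have hi₀ := hnonneg e i hi
      have hi₁ := hlen e i hi
      have hi₂ := hlt e i hi
      have e1 : G.pt e (t e i) = .vertex a ↔ G.src e = a ∧ t e i ≤ 0 := by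
        rcases hi₀.eq_or_lt with h | h
        · simp [← h]
        · simp [pt_interior h (hi₂.trans_le hi₁), not_le.2 h]
      have e2 : G.pt e (t e (i + 1)) = .vertex a ↔ G.tgt e = a ∧ G.len e ≤ t e (i + 1) := by
        rcases hi₁.eq_or_lt with h | h
        · simp [h]
        · simp [pt_interior (hi₀.trans_lt hi₂) h, not_le.2 h]
      have e3 : 0 < t e (i + 1) := hi₀.trans_lt hi₂
      have e4 : t e i < G.len e := hi₂.trans_le hi₁
      simp only [e1, e2, e3, e4, and_true, true_and, ite_and]
      split_ifs <;> ring
    | interior e₀ x hx₀ hx₁ =>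
      have h : G.arc (e₀, true) x = .interior e₀ x hx₀ hx₁ := pt_interior hx₀ hx₁
      rw [Finset.sum_eq_single e₀]
      · rw [← h, ordInt_arc f ⟨hx₀, hx₁⟩, hup e₀ x ⟨hx₀.le, hx₁⟩]
        have h2 := hdown e₀ x ⟨hx₀, hx₁.le⟩
        simp only [flip, Bool.not_true, h2]
        rw [← Finset.sum_neg_distrib, ← Finset.sum_add_distrib]
        refine Finset.sum_congr rfl fun i hi => ?_
        rw [Finset.mem_range] at hi
        rw [h]
        simp only [pt_eq_interior, true_and]
        have := hlt e₀ i hi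
        by_cases ha : t e₀ i = x
        · subst ha
          simp [this, this.ne', this.le]
        · by_cases hb : t e₀ (i + 1) = x
          · subst hb
            simp [this, this.ne]
          · have e1 : t e₀ i ≤ x ↔ t e₀ i < x := ⟨fun h => h.lt_of_ne ha, le_of_lt⟩
            have e2 : x ≤ t e₀ (i + 1) ↔ x < t e₀ (i + 1) :=
              ⟨fun h => h.lt_of_ne (Ne.symm hb), le_of_lt⟩
            simp only [ha, hb, e1, e2, if_false]; simp
      · intro e _ he
        refine Finset.sum_eq_zero fun i _ => ?_
        simp [pt_eq_interior, he]
      · simp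
  · rw [← degHom_apply, map_sum]
    refine Finset.sum_eq_zero fun e _ => ?_
    rw [map_sum]
    refine Finset.sum_eq_zero fun i _ => ?_
    rw [map_zsmul, map_sub, degHom_apply, degHom_apply, deg_single, deg_single, sub_self,
      smul_zero]

lemma linEquiv_iff {D D' : G.Divisor} :
    LinEquiv D D' ↔ ∃ f : G.Point → ℝ, HasSlopes f ∧ ∀ p, D p = D' p + ordInt f p := by
  refine exists_congr fun f => ?_
  rw [isRational_iff]
  refine and_congr_right fun hf => forall_congr' fun p => ?_
  rw [hf.ord_eq]
  norm_cast

lemma LinEquiv.refl (D : G.Divisor) : LinEquiv D D :=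
  linEquiv_iff.2 ⟨fun _ => 0, hasSlopes_const 0, fun p => by simp [ordInt_const]⟩

lemma LinEquiv.symm {D D' : G.Divisor} (h : LinEquiv D D') : LinEquiv D' D := by
  obtain ⟨f, hf, h⟩ := linEquiv_iff.1 h
  exact linEquiv_iff.2 ⟨-f, hf.neg, fun p => by rw [ordInt_neg hf, h p]; ring⟩

lemma LinEquiv.trans {D D' D'' : G.Divisor} (h : LinEquiv D D') (h' : LinEquiv D' D'') :
    LinEquiv D D'' := by
  obtain ⟨f, hf, h⟩ := linEquiv_iff.1 h
  obtain ⟨g, hg, h'⟩ := linEquiv_iff.1 h'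
  exact linEquiv_iff.2 ⟨g + f, hg.add hf, fun p => by rw [ordInt_add hg hf, h p, h' p]; ring⟩

lemma LinEquiv.add_right {D D' : G.Divisor} (h : LinEquiv D D') (F : G.Divisor) :
    LinEquiv (D + F) (D' + F) := by
  obtain ⟨f, hf, h⟩ := linEquiv_iff.1 h
  exact linEquiv_iff.2 ⟨f, hf, fun p => by
    rw [Finsupp.add_apply, Finsupp.add_apply, h p]; ring⟩

lemma HasSlopes.exists_linEquiv {f : G.Point → ℝ} (hf : HasSlopes f) (D : G.Divisor) :
    ∃ D' : G.Divisor, LinEquiv D' D ∧ ∀ p, D' p = D p + ordInt f p := by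
  obtain ⟨F, hF, -⟩ := hf.exists_divisor
  have h : ∀ p, (D + F) p = D p + ordInt f p := fun p => by rw [Finsupp.add_apply, hF]
  exact ⟨D + F, linEquiv_iff.2 ⟨f, hf, h⟩, h⟩

end MetricGraph

namespace MetricGraph

open Filter Topology

variable {V E : Type*} {G : MetricGraph V E}

/-! ### A maximum principle on oriented edges -/

lemma HasSlope.le_of_eventually_le {f : G.Point → ℝ} {d : E × Bool} {s : ℝ} {k l : ℤ}
    (hk : HasSlope f d s k) (h : ∀ᶠ u in 𝓝[>] s, f (G.arc d u) ≤ f (G.arc d s) + l * (u - s)) :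
    k ≤ l := by
  obtain ⟨u, ⟨h1, h2⟩, h3⟩ := ((hk.and h).and self_mem_nhdsWithin).exists
  have h4 : (0 : ℝ) < u - s := sub_pos.2 h3
  have : (k : ℝ) * (u - s) ≤ l * (u - s) := by linarith
  exact_mod_cast le_of_mul_le_mul_right this h4

lemma HasSlope.nonpos_of_max {f : G.Point → ℝ} {d : E × Bool} {s : ℝ} {k : ℤ}
    (hk : HasSlope f d s k) (h : ∀ q, f q ≤ f (G.arc d s)) : k ≤ 0 :=
  hk.le_of_eventually_le (Eventually.of_forall fun u => by simpa using h _)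

/-- A function whose orders are nonnegative along an open interval lies above its tangent at the
beginning of this interval. -/
lemma HasSlopes.tangent_le [Fintype E] {f : G.Point → ℝ} (hf : HasSlopes f) {d : E × Bool}
    {s r y : ℝ} (hs : 0 ≤ s) (hr : r ≤ G.len d.1)
    (hord : ∀ u ∈ Ioo s r, 0 ≤ ordInt f (G.arc d u)) (hy : y ∈ Icc s r) :
    f (G.arc d s) + slp f d s * (y - s) ≤ f (G.arc d y) := by
  by_contra! hlt
  have hsy : s < y := by
    rcases hy.1.eq_or_lt with rfl | h
    · simp at hlt
    · exact h
  set k := slp f d s with hk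
  -- Subtract the tangent and take the last maximum `z` of the difference `g` on `[s, y]`. To the
  -- right of `z` the slope of `g` is negative, and in the reverse direction it is at most 0. So `z
  -- = s` contradicts the choice of `k`, and an inner `z` has negative order.
  set g : ℝ → ℝ := fun u => f (G.arc d u) - k * (u - s) with hg
  have hgc : ContinuousOn g (Icc s y) :=
    ((hf.continuousOn d).mono (Icc_subset_Icc hs (hy.2.trans hr))).sub (by fun_prop)
  obtain ⟨m, hm, hmax⟩ := isCompact_Icc.exists_isMaxOn ⟨s, le_rfl, hsy.le⟩ hgc
  have hclosed : IsClosed (Icc s y ∩ g ⁻¹' Ici (g m)) :=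
    hgc.preimage_isClosed_of_isClosed isClosed_Icc isClosed_Ici
  obtain ⟨z, ⟨hzI, hzm⟩, hzlast⟩ :=
    (isCompact_Icc.of_isClosed_subset hclosed inter_subset_left).exists_isGreatest
      ⟨m, hm, le_refl (g m)⟩
  have hzmax : ∀ u ∈ Icc s y, g u ≤ g z := fun u hu => (hmax hu).trans hzm
  have hzy : z < y := by
    refine hzI.2.lt_of_ne ?_
    rintro rfl
    have := hzmax s ⟨le_rfl, hsy.le⟩
    simp only [hg] at this
    linarith
  have hk1 := hf.hasSlope (d := d) (s := z) ⟨hs.trans hzI.1, hzy.trans_le (hy.2.trans hr)⟩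
  have h1 : slp f d z < k := by
    obtain ⟨u, hu, hu1, hu2⟩ := (hk1.and (Ioo_mem_nhdsGT hzy)).exists
    have h4 : (0 : ℝ) < u - z := sub_pos.2 hu1
    have hns : g u < g m := by
      by_contra! hcon
      exact absurd (hzlast ⟨⟨hzI.1.trans hu1.le, hu2.le⟩, hcon⟩) (not_le.2 hu1)
    have : g u < g z := hns.trans_le hzm
    simp only [hg, hu] at this
    have h5 : (slp f d z : ℝ) * (u - z) < k * (u - z) := by linarith
    exact_mod_cast lt_of_mul_lt_mul_right h5 h4.le
  rcases hzI.1.eq_or_lt with rfl | hsz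
  · exact lt_irrefl _ h1
  have hzL : z < G.len d.1 := hzy.trans_le (hy.2.trans hr)
  have hk2 := hf.hasSlope (d := flip d) (s := G.len d.1 - z)
    ⟨by simpa using hzL.le, by simpa using hs.trans_lt hsz⟩
  have h2 : slp f (flip d) (G.len d.1 - z) ≤ -k := by
    refine hk2.le_of_eventually_le ?_
    filter_upwards [Ioo_mem_nhdsGT (show G.len d.1 - z < G.len d.1 - s by linarith)] with u hu
    have := hzmax (G.len d.1 - u) ⟨by linarith [hu.2], by linarith [hu.1]⟩
    simp only [hg] at this
    rw [arc_flip, arc_flip, sub_sub_cancel]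
    push_cast
    linarith
  have := hord z ⟨hsz, hzy.trans_le hy.2⟩
  rw [ordInt_arc f ⟨hs.trans_lt hsz, hzL⟩] at this
  linarith

/-- Each closed edge is compact; the finitely many edge maxima and vertex values are then compared.
-/
lemma HasSlopes.exists_max [Fintype V] [Fintype E] {f : G.Point → ℝ} (hf : HasSlopes f) :
    ∃ p, ∀ q, f q ≤ f p := by
  have h1 : ∀ e, ∃ t ∈ Icc 0 (G.len e), ∀ u ∈ Icc 0 (G.len e), f (G.pt e u) ≤ f (G.pt e t) :=
    fun e => isCompact_Icc.exists_isMaxOn ⟨0, le_rfl, (G.len_pos e).le⟩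
      (hf.continuousOn (e, true))
  choose t _ ht using h1
  have := G.nonempty
  obtain ⟨x, hx⟩ := Finite.exists_max
    (fun x : V ⊕ E => f (Sum.elim Point.vertex (fun e => G.pt e (t e)) x))
  refine ⟨Sum.elim Point.vertex (fun e => G.pt e (t e)) x, fun q => ?_⟩
  cases q with
  | vertex a => exact hx (Sum.inl a)
  | interior e s h₀ h₁ =>
    rw [← pt_interior h₀ h₁]
    exact (ht e s ⟨h₀.le, h₁.le⟩).trans (hx (Sum.inr e))

/-! ### Segments between consecutive points of a finite set -/

/-- The parameter of the first point of `Z` after the parameter `s` on an oriented edge. -/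
def nextPos (Z : Set G.Point) (d : E × Bool) (s : ℝ) : ℝ :=
  sInf {u | u ∈ Ioc s (G.len d.1) ∧ G.arc d u ∈ Z}

lemma finite_arc_mem {Z : Set G.Point} (hfin : Z.Finite) (d : E × Bool) :
    {u | u ∈ Ioo 0 (G.len d.1) ∧ G.arc d u ∈ Z}.Finite := by
  refine Set.Finite.of_finite_image (f := G.arc d) (hfin.subset ?_) ?_
  · rintro _ ⟨u, hu, rfl⟩; exact hu.2
  · intro u _ v hv h; exact arc_inj_Ioo hv.1 h

lemma isLeast_nextPos {Z : Set G.Point} (hfin : Z.Finite) (hZ : G.branching ⊆ Z) {d : E × Bool}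
    {s : ℝ} (hs : s ∈ Ico 0 (G.len d.1)) :
    IsLeast {u | u ∈ Ioc s (G.len d.1) ∧ G.arc d u ∈ Z} (nextPos Z d s) := by
  set S := {u | u ∈ Ioc s (G.len d.1) ∧ G.arc d u ∈ Z} with hS
  have hne : S.Nonempty := ⟨_, ⟨hs.2, le_rfl⟩, hZ (arc_mem_branching_right d)⟩
  have hSfin : S.Finite := by
    refine ((finite_arc_mem hfin d).insert (G.len d.1)).subset fun u hu => ?_
    rcases hu.1.2.eq_or_lt with h | h
    · exact Or.inl h
    · exact Or.inr ⟨⟨hs.1.trans_lt hu.1.1, h⟩, hu.2⟩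
  exact ⟨hne.csInf_mem hSfin, fun u hu => csInf_le hSfin.bddBelow hu⟩

lemma nextPos_eq {Z : Set G.Point} {d : E × Bool} {s n : ℝ} (hn : n ∈ Ioc s (G.len d.1))
    (hnZ : G.arc d n ∈ Z) (h : ∀ u ∈ Ioo s n, G.arc d u ∉ Z) : nextPos Z d s = n := by
  have : IsLeast {u | u ∈ Ioc s (G.len d.1) ∧ G.arc d u ∈ Z} n := by
    refine ⟨⟨hn, hnZ⟩, fun u hu => ?_⟩
    by_contra! hlt
    exact h u ⟨hu.1.1, hlt⟩ hu.2
  exact this.csInf_eq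

lemma notMem_of_lt_nextPos {Z : Set G.Point} (hfin : Z.Finite) (hZ : G.branching ⊆ Z)
    {d : E × Bool} {s u : ℝ} (hs : s ∈ Ico 0 (G.len d.1)) (hu : u ∈ Ioo s (nextPos Z d s)) :
    G.arc d u ∉ Z := by
  intro h
  have h1 := isLeast_nextPos hfin hZ hs
  exact absurd (h1.2 ⟨⟨hu.1, hu.2.le.trans h1.1.1.2⟩, h⟩) (not_le.2 hu.2)

/-- The first point of `Z` on the oriented edge `d`, starting from `p`. -/
def next (Z : Set G.Point) (p : G.Point) (d : E × Bool) : G.Point :=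
  G.arc d (nextPos Z d (coord p d))

lemma not_precedes_self (P : List G.Point) (p : G.Point) : ¬Precedes P p p := lt_irrefl _

open Classical in
/-- The direction in which a segment leaves the point `v`. -/
def segmentDirection (v : G.Point) (S : G.Segment) : E × Bool :=
  -- In `segmentsBelow P v` a segment cannot have both ends at `v`, because `v` does not precede
  -- itself, so this test is unambiguous there.
  (S.edge, decide (G.pt S.edge S.lo = v))

lemma nu_apply_of_notMem {P : List G.Point} {v : G.Point} (hv : v ∉ P) : nu P v = 0 := by
  classical
  rw [nu, Finsupp.finsetSum_apply]
  refine Finset.sum_eq_zero fun p hp => Finsupp.single_eq_of_ne ?_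
  rintro rfl
  exact hv (List.mem_toFinset.1 hp)

variable [Fintype E]

lemma next_mem {Z : Set G.Point} (hfin : Z.Finite) (hZ : G.branching ⊆ Z) {p : G.Point}
    {d : E × Bool} (hd : d ∈ tangents p) : next Z p d ∈ Z :=
  (isLeast_nextPos hfin hZ (coord_mem hd)).1.2

/-- A segment is recovered from its direction at `v`: one end is `v` and the other is the first
point of `P` that is met. This yields the injectivity used in counting. -/
lemma segmentDirection_spec {P : List G.Point} {v : G.Point} {S : G.Segment}
    (hS : S ∈ segmentsBelow P v) :
    segmentDirection v S ∈ tangents v ∧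
    Precedes P (next {p | p ∈ P} v (segmentDirection v S)) v ∧
    (S.lo = if (segmentDirection v S).2 then coord v (segmentDirection v S) else
      G.len S.edge - nextPos {p | p ∈ P} (segmentDirection v S)
        (coord v (segmentDirection v S))) ∧
    (S.hi = if (segmentDirection v S).2 then
      nextPos {p | p ∈ P} (segmentDirection v S) (coord v (segmentDirection v S)) else
      G.len S.edge - coord v (segmentDirection v S)) := by
  obtain ⟨⟨h1, h2, h3⟩, h⟩ := hS
  have hlo := S.lo_nonneg
  have hlt := S.lo_lt_hi
  have hhi := S.hi_le
  rcases h with ⟨hv, hprec⟩ | ⟨hv, hprec⟩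
  · have hd : segmentDirection v S = (S.edge, true) := by simp [segmentDirection, hv]
    have harc : G.arc (S.edge, true) S.lo = v := hv
    have hI : S.lo ∈ Ico 0 (G.len (S.edge, true).1) := ⟨hlo, hlt.trans_le hhi⟩
    have hc : coord v (S.edge, true) = S.lo := by rw [← harc, coord_arc hI]
    have hn : nextPos {p | p ∈ P} (S.edge, true) S.lo = S.hi :=
      nextPos_eq ⟨hlt, hhi⟩ h2 h3
    rw [hd, next, hc, hn]
    refine ⟨?_, hprec, by simp, by simp⟩
    rw [← harc]; exact arc_mem_tangents hI
  · have hne : G.pt S.edge S.lo ≠ v := by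
      intro h; rw [h] at hprec; exact not_precedes_self P v hprec
    have hd : segmentDirection v S = (S.edge, false) := by simp [segmentDirection, hne]
    have harc : G.arc (S.edge, false) (G.len S.edge - S.hi) = v := by
      rw [arc_false, sub_sub_cancel]; exact hv
    have hI : G.len S.edge - S.hi ∈ Ico 0 (G.len (S.edge, false).1) :=
      ⟨by simpa using hhi, by simpa using hlo.trans_lt hlt⟩
    have hc : coord v (S.edge, false) = G.len S.edge - S.hi := by rw [← harc, coord_arc hI]
    have hn : nextPos {p | p ∈ P} (S.edge, false) (G.len S.edge - S.hi) = G.len S.edge - S.lo := by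
      refine nextPos_eq ⟨by linarith, by simpa using hlo⟩ ?_ fun u hu => ?_
      · rw [arc_false, sub_sub_cancel]; exact h1
      · exact h3 (G.len S.edge - u) ⟨by linarith [hu.2], by linarith [hu.1]⟩
    rw [hd, next, hc, hn]
    refine ⟨?_, ?_, by simp, by simp⟩
    · rw [← harc]; exact arc_mem_tangents hI
    · rw [arc_false, sub_sub_cancel]; exact hprec

open Classical in
-- Segments below `v` correspond bijectively to directions at `v` whose next point of `P` precedes
-- `v`. All later arguments count directions, where slopes live.
lemma ncard_segmentsBelow {P : List G.Point} (hP : G.branching ⊆ {p | p ∈ P}) {v : G.Point}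
    (hv : v ∈ P) : (segmentsBelow P v).ncard =
      ((tangents v).filter fun d => Precedes P (next {p | p ∈ P} v d) v).card := by
  have hfin : {p | p ∈ P}.Finite := P.finite_toSet
  rw [← Set.ncard_coe_finset, ← Set.InjOn.ncard_image (f := segmentDirection v)]
  · congr 1
    ext d
    simp only [mem_image, Finset.coe_filter, mem_ofPred_eq]
    constructor
    · rintro ⟨S, hS, rfl⟩
      exact ⟨(segmentDirection_spec hS).1, (segmentDirection_spec hS).2.1⟩
    · rintro ⟨hd, hprec⟩
      have hI := coord_mem hd
      have hc := arc_coord hd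
      have h1 := isLeast_nextPos hfin hP hI
      have h2 := fun u hu => notMem_of_lt_nextPos (u := u) hfin hP hI hu
      rw [next] at hprec
      set s := coord v d with hs
      set n := nextPos {p | p ∈ P} d s with hn
      rcases d with ⟨e, _ | _⟩
      · rw [arc_false] at hc hprec
        have hsn : s < n := h1.1.1.1
        have hnL : n ≤ G.len e := h1.1.1.2
        refine ⟨⟨e, G.len e - n, G.len e - s, by linarith, by linarith, by linarith [hI.1]⟩,
          ⟨⟨h1.1.2, ?_, fun x hx => ?_⟩, Or.inr ⟨hc, hprec⟩⟩, ?_⟩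
        · exact hc ▸ hv
        · have := h2 (G.len e - x) ⟨by linarith [hx.2], by linarith [hx.1]⟩
          rwa [arc_false, sub_sub_cancel] at this
        · have : G.pt e (G.len e - n) ≠ v := by
            intro h; rw [h] at hprec; exact not_precedes_self P v hprec
          simp [segmentDirection, this]
      · rw [arc_true] at hc hprec
        refine ⟨⟨e, s, n, hI.1, h1.1.1.1, h1.1.1.2⟩, ⟨⟨?_, h1.1.2, h2⟩, Or.inl ⟨hc, hprec⟩⟩, ?_⟩
        · exact hc ▸ hv
        · simp [segmentDirection, hc]
  · intro S hS S' hS' h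
    obtain ⟨-, -, h1, h2⟩ := segmentDirection_spec hS
    obtain ⟨-, -, h1', h2'⟩ := segmentDirection_spec hS'
    have he : S.edge = S'.edge := congrArg Prod.fst h
    rw [← h, ← he] at h1' h2'
    cases S; cases S'
    simp only [Segment.mk.injEq]
    exact ⟨he, h1.trans h1'.symm, h2.trans h2'.symm⟩

open Classical in
lemma nu_apply {P : List G.Point} (hP : G.branching ⊆ {p | p ∈ P}) {v : G.Point} (hv : v ∈ P) :
    nu P v = (((tangents v).filter fun d =>
      Precedes P (next {p | p ∈ P} v d) v).card : ℤ) - 1 := by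
  rw [nu, Finsupp.finsetSum_apply, Finset.sum_eq_single v, Finsupp.single_eq_same,
    ncard_segmentsBelow hP hv]
  · intro p _ hp
    exact Finsupp.single_eq_of_ne hp.symm
  · intro h
    exact absurd (List.mem_toFinset.2 hv) h

/-! ### The divisor of a permutation is not equivalent to an effective divisor -/

/-- The deficient point is the first point of `P` at which `f` is maximal, since `f` must strictly
decrease towards every neighbour preceding it. -/
lemma exists_nu_add_ordInt_neg [Fintype V] {P : List G.Point} (hP : G.branching ⊆ {p | p ∈ P})
    {f : G.Point → ℝ} (hf : HasSlopes f) : ∃ p, nu P p + ordInt f p < 0 := by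
  classical
  by_contra! hcon
  have hfin : {p | p ∈ P}.Finite := P.finite_toSet
  have hord : ∀ p, p ∉ P → 0 ≤ ordInt f p := fun p hp => by
    simpa [nu_apply_of_notMem hp] using hcon p
  have hslope : ∀ p, (∀ q, f q ≤ f p) → ∀ d ∈ tangents p, slp f d (coord p d) ≤ 0 := by
    intro p hp d hd
    refine (hf.hasSlope (coord_mem hd)).nonpos_of_max ?_
    rwa [arc_coord hd]
  have hnext : ∀ p, (∀ q, f q ≤ f p) → ∀ d ∈ tangents p, 0 ≤ slp f d (coord p d) →
      ∀ q, f q ≤ f (next {p | p ∈ P} p d) := by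
    intro p hp d hd h0 q
    have hI := coord_mem hd
    have h1 := isLeast_nextPos hfin hP hI
    have h2 := hf.tangent_le hI.1 h1.1.1.2
      (fun u hu => hord _ (notMem_of_lt_nextPos hfin hP hI hu)) ⟨h1.1.1.1.le, le_rfl⟩
    rw [arc_coord hd] at h2
    have h3 : (0 : ℝ) ≤ slp f d (coord p d) * (nextPos {p | p ∈ P} d (coord p d) - coord p d) :=
      mul_nonneg (by exact_mod_cast h0) (by linarith [h1.1.1.1])
    exact (hp q).trans (by rw [next]; linarith)
  -- A maximum off `P` lies inside an edge, where both slopes are at most 0 and their sum is at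
  -- least 0; moving on to the next point of `P` keeps the maximal value.
  obtain ⟨w, hwP, hw⟩ : ∃ w ∈ P, ∀ q, f q ≤ f w := by
    obtain ⟨p, hp⟩ := hf.exists_max
    by_cases hpP : p ∈ P
    · exact ⟨p, hpP, hp⟩
    obtain ⟨d, s, hs, rfl⟩ := exists_arc_of_notMem_branching fun h => hpP (hP h)
    have hd : d ∈ tangents (G.arc d s) := arc_mem_tangents ⟨hs.1.le, hs.2⟩
    refine ⟨_, next_mem hfin hP hd, hnext _ hp d hd ?_⟩
    have h1 := hord _ hpP
    have h2 := hslope _ hp (flip d) (by rw [tangents_arc hs]; simp)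
    rw [ordInt, tangents_arc hs, Finset.sum_pair (flip_ne d).symm] at h1
    linarith
  obtain ⟨v, hv, hmin⟩ := Finset.exists_min_image
    (P.toFinset.filter fun w => ∀ q, f q ≤ f w) (fun w => P.idxOf w)
    ⟨w, Finset.mem_filter.2 ⟨List.mem_toFinset.2 hwP, hw⟩⟩
  rw [Finset.mem_filter, List.mem_toFinset] at hv
  obtain ⟨hvP, hvmax⟩ := hv
  -- A slope at least 0 towards a preceding point would make that point maximal, against the
  -- minimality of the index of `v`; by integrality the slope is at most -1.
  have h1 : ordInt f v ≤ ∑ d ∈ tangents v,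
      if Precedes P (next {p | p ∈ P} v d) v then (-1 : ℤ) else 0 := by
    refine Finset.sum_le_sum fun d hd => ?_
    have h0 := hslope v hvmax d hd
    split_ifs with hprec
    · by_contra! hlt
      have := hmin (next {p | p ∈ P} v d) (Finset.mem_filter.2
        ⟨List.mem_toFinset.2 (next_mem hfin hP hd), hnext v hvmax d hd (by omega)⟩)
      exact absurd this (not_le.2 hprec)
    · exact h0
  have h2 := hcon v
  rw [nu_apply hP hvP] at h2
  rw [← Finset.sum_filter, Finset.sum_const] at h1
  simp only [nsmul_eq_mul] at h1
  linarith

end MetricGraph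

namespace MetricGraph

open Filter Topology

variable {V E : Type*} {G : MetricGraph V E}

/-! ### Slopes of rational functions with bounded poles -/

section SlopeBound

variable [Fintype E]

/-- If the poles of a rational function are bounded by `A`, then its slopes are bounded by the
degree of `A`. -/
lemma HasSlopes.slp_le {f : G.Point → ℝ} (hf : HasSlopes f) {A : G.Divisor} (hA : 0 ≤ A)
    (h : ∀ p, -A p ≤ ordInt f p) {d : E × Bool} {s : ℝ} (hs : s ∈ Ico 0 (G.len d.1)) :
    slp f d s ≤ deg A := by
  classical
  by_contra! hlt
  set x := G.arc d s with hx
  -- Truncating `f` below at its value at `x` makes all slopes at `x` nonnegative and keeps the one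
  -- along `d`, while poles stay bounded by `A`. As the orders of `g` sum to 0, the order at `x` is
  -- at most `deg A`.
  set g : G.Point → ℝ := f ⊔ fun _ => f x with hg
  have hgs : HasSlopes g := hf.sup (hasSlopes_const _)
  obtain ⟨F, hF, hF0⟩ := hgs.exists_divisor
  have hslp : ∀ p, ∀ d' ∈ tangents p, slp g d' (coord p d') =
      if f x < f p then slp f d' (coord p d') else if f p < f x then 0 else
        max (slp f d' (coord p d')) 0 := by
    intro p d' hd'
    have := ((hf.hasSlope (coord_mem hd')).sup (hasSlope_const (f x) d' _)).slp_eq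
    rwa [arc_coord hd'] at this
  have hordx : slp f d s ≤ ordInt g x := by
    have hd : d ∈ tangents x := arc_mem_tangents hs
    have h1 : ∀ d' ∈ tangents x, slp g d' (coord x d') = max (slp f d' (coord x d')) 0 :=
      fun d' hd' => by simpa using hslp x d' hd'
    have h2 : slp g d (coord x d) ≤ ordInt g x :=
      Finset.single_le_sum (f := fun d' => slp g d' (coord x d'))
        (fun d' hd' => by rw [h1 d' hd']; exact le_max_right _ _) hd
    rw [h1 d hd, coord_arc hs] at h2
    exact (le_max_left _ _).trans h2
  have hord : ∀ p, -A p ≤ ordInt g p := by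
    intro p
    by_cases h1 : f x < f p
    · refine (h p).trans (Finset.sum_le_sum fun d' hd' => ?_)
      rw [hslp p d' hd', if_pos h1]
    · refine (neg_nonpos.2 (hA p)).trans (Finset.sum_nonneg fun d' hd' => ?_)
      rw [hslp p d' hd', if_neg h1]
      split_ifs
      · exact le_rfl
      · exact le_max_right _ _
  have hle : Finsupp.single x (slp f d s) ≤ F + A := by
    intro p
    rw [Finsupp.add_apply, hF, Finsupp.single_apply]
    split_ifs with hp
    · rw [← hp]
      have : 0 ≤ A x := hA x
      linarith
    · linarith [hord p]
  have := deg_mono hle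
  rw [deg_single, deg_add, hF0, zero_add] at this
  exact absurd this (not_le.2 hlt)

lemma HasSlopes.le_add_mul {f : G.Point → ℝ} (hf : HasSlopes f) {A : G.Divisor} (hA : 0 ≤ A)
    (h : ∀ p, -A p ≤ ordInt f p) {d : E × Bool} {s y : ℝ} (hs : 0 ≤ s) (hsy : s ≤ y)
    (hy : y ≤ G.len d.1) : f (G.arc d y) ≤ f (G.arc d s) + deg A * (y - s) := by
  refine image_le_of_deriv_right_le_deriv_boundary (a := s) (b := y)
    (f := fun u => f (G.arc d u)) (f' := fun u => (slp f d u : ℝ))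
    (B := fun u => f (G.arc d s) + deg A * (u - s)) (B' := fun _ => (deg A : ℝ))
    ((hf.continuousOn d).mono (Icc_subset_Icc hs hy)) (fun u hu => ?_) (by simp)
    (by fun_prop) (fun u _ => ?_) (fun u hu => ?_) ⟨hsy, le_rfl⟩
  · exact (hf.hasSlope ⟨hs.trans hu.1, hu.2.trans_le hy⟩).hasDerivWithinAt
  · have := (((hasDerivAt_id u).sub_const s).const_mul (deg A : ℝ)).const_add (f (G.arc d s))
    simpa using this.hasDerivWithinAt
  · exact_mod_cast hf.slp_le hA h ⟨hs.trans hu.1, hu.2.trans_le hy⟩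

/-- The one-sided estimate holds for both orientations of the edge, which makes `f` Lipschitz with
constant `deg A`. -/
lemma HasSlopes.abs_sub_le {f : G.Point → ℝ} (hf : HasSlopes f) {A : G.Divisor} (hA : 0 ≤ A)
    (h : ∀ p, -A p ≤ ordInt f p) {d : E × Bool} {s y : ℝ} (hs : 0 ≤ s) (hsy : s ≤ y)
    (hy : y ≤ G.len d.1) : |f (G.arc d y) - f (G.arc d s)| ≤ deg A * (y - s) := by
  rw [abs_le]
  have h1 := hf.le_add_mul hA h hs hsy hy
  have h2 := hf.le_add_mul hA h (d := flip d) (s := G.len d.1 - y) (y := G.len d.1 - s)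
    (by linarith) (by linarith) (by simpa using hs)
  rw [arc_flip, arc_flip, sub_sub_cancel, sub_sub_cancel] at h2
  constructor <;> linarith

lemma HasSlopes.neg_le_slp {f : G.Point → ℝ} (hf : HasSlopes f) {A : G.Divisor} (hA : 0 ≤ A)
    (h : ∀ p, -A p ≤ ordInt f p) {d : E × Bool} {s : ℝ} (hs : s ∈ Ico 0 (G.len d.1)) :
    -deg A ≤ slp f d s := by
  have h1 : -slp f d s ≤ deg A := by
    refine (hf.hasSlope hs).neg.le_of_eventually_le ?_
    filter_upwards [Ioo_mem_nhdsGT hs.2] with u hu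
    have := (abs_le.1 (hf.abs_sub_le hA h hs.1 hu.1.le hu.2.le)).1
    simp only [Pi.neg_apply]
    linarith
  linarith

end SlopeBound

/-! ### The largest rational function with bounded poles -/

/-- A function which is a maximum of finitely many affine functions with integral slopes is
affine with integral slope to the right of a point. -/
lemma eventually_affine_of_max {K : Finset ℤ} {c : ℤ → ℝ} {s r : ℝ} {φ : ℝ → ℝ} (hsr : s < r)
    (h₁ : ∀ k ∈ K, ∀ u ∈ Ico s r, k * (u - s) + c k ≤ φ u)
    (h₂ : ∀ u ∈ Ico s r, ∃ k ∈ K, φ u ≤ k * (u - s) + c k) :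
    ∃ k : ℤ, ∀ᶠ u in 𝓝[>] s, φ u = φ s + k * (u - s) := by
  classical
  have hs : s ∈ Ico s r := ⟨le_rfl, hsr⟩
  -- Among the lines attaining the maximum at `s`, the steepest one dominates just after `s`; the
  -- lines strictly below at `s` stay below for a while by continuity.
  obtain ⟨k₀, hk₀, hmax₀⟩ := Finset.exists_max_image K c (let ⟨k, hk, _⟩ := h₂ s hs; ⟨k, hk⟩)
  obtain ⟨k, hk, hmax⟩ := Finset.exists_max_image (K.filter fun k => c k = c k₀) id
    ⟨k₀, Finset.mem_filter.2 ⟨hk₀, rfl⟩⟩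
  obtain ⟨hkK, hkc⟩ := Finset.mem_filter.1 hk
  have hφs : φ s = c k := by
    obtain ⟨l, hl, hl'⟩ := h₂ s hs
    have := h₁ k hkK s hs
    simp only [sub_self, mul_zero, zero_add] at hl' this
    exact le_antisymm (hl'.trans (hkc ▸ hmax₀ l hl)) this
  have hev : ∀ᶠ u in 𝓝[>] s, ∀ l ∈ K, l * (u - s) + c l ≤ k * (u - s) + c k := by
    rw [Filter.eventually_all_finset]
    intro l hl
    rcases (hmax₀ l hl).eq_or_lt with h | h
    · have hlk : l ≤ k := hmax l (Finset.mem_filter.2 ⟨hl, h⟩)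
      filter_upwards [self_mem_nhdsWithin] with u hu
      have hu : (0 : ℝ) ≤ u - s := (sub_pos.2 hu).le
      rw [h, hkc]
      have : (l : ℝ) * (u - s) ≤ k * (u - s) :=
        mul_le_mul_of_nonneg_right (by exact_mod_cast hlk) hu
      linarith
    · rw [← hkc] at h
      have hc₁ : Continuous fun u : ℝ => l * (u - s) + c l := by fun_prop
      have hc₂ : Continuous fun u : ℝ => k * (u - s) + c k := by fun_prop
      have := (hc₁.tendsto s).eventually_lt (hc₂.tendsto s) (by simpa using h)
      exact (this.filter_mono nhdsWithin_le_nhds).mono fun u hu => hu.le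
  refine ⟨k, ?_⟩
  filter_upwards [hev, Ioo_mem_nhdsGT hsr] with u hu hur
  have hur' : u ∈ Ico s r := ⟨hur.1.le, hur.2⟩
  obtain ⟨l, hl, hl'⟩ := h₂ u hur'
  rw [hφs]
  linarith [h₁ k hkK u hur', hu l hl]

lemma HasSlope.eventually_add {f : G.Point → ℝ} {d : E × Bool} {s : ℝ} {k : ℤ}
    (h : HasSlope f d s k) :
    ∀ᶠ t in 𝓝[>] (0 : ℝ), f (G.arc d (s + t)) = f (G.arc d s) + k * t := by
  have ht : Tendsto (fun t => s + t) (𝓝[>] (0 : ℝ)) (𝓝[>] s) := by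
    refine tendsto_nhdsWithin_of_tendsto_nhds_of_eventually_within _ ?_ ?_
    · have := ((continuous_const (y := s)).add continuous_id).tendsto 0
      simp only [id, Pi.add_apply, add_zero] at this
      exact this.mono_left nhdsWithin_le_nhds
    · filter_upwards [self_mem_nhdsWithin] with t ht
      simpa using ht
  filter_upwards [ht.eventually h] with t ht
  rw [ht]; ring

variable [Fintype E]

/-- The rational functions vanishing at `p₀` whose poles are bounded by `A`. -/
def Admissible (A : G.Divisor) (p₀ : G.Point) (f : G.Point → ℝ) : Prop :=
  HasSlopes f ∧ f p₀ = 0 ∧ ∀ p, -A p ≤ ordInt f p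

lemma admissible_zero {A : G.Divisor} (hA : 0 ≤ A) (p₀ : G.Point) :
    Admissible A p₀ fun _ => 0 :=
  ⟨hasSlopes_const 0, rfl, fun p => by rw [ordInt_const]; exact neg_nonpos.2 (hA p)⟩

/-- The relation of having differences bounded uniformly over all admissible functions is an
equivalence relation. It relates the points of an edge by the Lipschitz bound, hence all points by
connectedness; comparison with `p₀` gives the bound. -/
lemma admissible_bounded {A : G.Divisor} (hA : 0 ≤ A) (p₀ p : G.Point) :
    ∃ M, ∀ f, Admissible A p₀ f → f p ≤ M := by
  let R : G.Point → G.Point → Prop := fun p q => ∃ M, ∀ f, Admissible A p₀ f → |f p - f q| ≤ M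
  have hrefl : ∀ p, R p p := fun p => ⟨0, fun f _ => by simp⟩
  have hsymm : ∀ {p q}, R p q → R q p := fun ⟨M, hM⟩ =>
    ⟨M, fun f hf => by rw [abs_sub_comm]; exact hM f hf⟩
  have htrans : ∀ {p q w}, R p q → R q w → R p w := fun ⟨M, hM⟩ ⟨N, hN⟩ =>
    ⟨M + N, fun f hf => (abs_sub_le _ _ _).trans (add_le_add (hM f hf) (hN f hf))⟩
  have hedge : ∀ e t, t ∈ Icc 0 (G.len e) → R (G.pt e t) (.vertex (G.src e)) := fun e t ht =>
    ⟨deg A * (t - 0), fun f hf => by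
      have := hf.1.abs_sub_le hA hf.2.2 (d := (e, true)) le_rfl ht.1 ht.2
      rwa [arc_true, arc_true, pt_zero] at this⟩
  have hvertex : ∀ a b : V, R (.vertex a) (.vertex b) := by
    intro a b
    induction G.connected a b with
    | rel a b h =>
      obtain ⟨e, rfl, rfl⟩ := h
      have := hedge e (G.len e) ⟨(G.len_pos e).le, le_rfl⟩
      rw [pt_len] at this
      exact hsymm this
    | refl a => exact hrefl _
    | symm a b _ h => exact hsymm h
    | trans a b c _ _ h h' => exact htrans h h'
  have hpoint : ∀ p : G.Point, ∃ a, R p (.vertex a) := by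
    intro p
    cases p with
    | vertex a => exact ⟨a, hrefl _⟩
    | interior e t h₀ h₁ =>
      rw [← pt_interior h₀ h₁]
      exact ⟨_, hedge e t ⟨h₀.le, h₁.le⟩⟩
  obtain ⟨a, ha⟩ := hpoint p
  obtain ⟨b, hb⟩ := hpoint p₀
  obtain ⟨M, hM⟩ := htrans (htrans ha (hvertex a b)) (hsymm hb)
  refine ⟨M, fun f hf => ?_⟩
  have := (le_abs_self _).trans (hM f hf)
  rwa [hf.2.1, sub_zero] at this

/-- A function whose orders are nonnegative along an open interval lies above each of its
tangents along this interval. -/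
lemma HasSlopes.tangent_le' {f : G.Point → ℝ} (hf : HasSlopes f) {d : E × Bool}
    {s r u y : ℝ} (hs : 0 ≤ s) (hr : r ≤ G.len d.1)
    (hord : ∀ u ∈ Ioo s r, 0 ≤ ordInt f (G.arc d u)) (hu : u ∈ Ico s r) (hy : y ∈ Icc s r) :
    f (G.arc d u) + slp f d u * (y - u) ≤ f (G.arc d y) := by
  rcases le_or_gt u y with huy | hyu
  · exact hf.tangent_le (hs.trans hu.1) hr
      (fun v hv => hord v ⟨hu.1.trans_lt hv.1, hv.2⟩) ⟨huy, hy.2⟩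
  -- To the left of `u` the reversed edge is used: its slope at `u` is at least `-slp f d u`,
  -- because the order at `u` is nonnegative.
  · have hsu : s < u := hy.1.trans_lt hyu
    have h0 := hord u ⟨hsu, hu.2⟩
    rw [ordInt_arc f ⟨hs.trans_lt hsu, hu.2.trans_le hr⟩] at h0
    have h1 := hf.tangent_le (d := flip d) (s := G.len d.1 - u) (r := G.len d.1 - s)
      (y := G.len d.1 - y) (by linarith [hu.2]) (by simpa using hs) (fun v hv => by
        rw [arc_flip]
        exact hord _ ⟨by linarith [hv.2], by linarith [hv.1, hu.2]⟩)
      ⟨by linarith, by linarith [hy.1]⟩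
    rw [arc_flip, arc_flip, sub_sub_cancel, sub_sub_cancel] at h1
    have h2 : (-slp f d u : ℝ) * (u - y) ≤ slp f (flip d) (G.len d.1 - u) * (u - y) :=
      mul_le_mul_of_nonneg_right (by exact_mod_cast (by linarith)) (by linarith)
    linarith

lemma exists_largest_admissible [Fintype V] {A : G.Divisor} (hA : 0 ≤ A) (p₀ : G.Point) :
    ∃ h, Admissible A p₀ h ∧ ∀ f, Admissible A p₀ f → ∀ p, f p ≤ h p := by
  classical
  let ι := {f : G.Point → ℝ // Admissible A p₀ f}
  have : Nonempty ι := ⟨⟨_, admissible_zero hA p₀⟩⟩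
  have hbdd : ∀ p, BddAbove (range fun f : ι => f.1 p) := by
    intro p
    obtain ⟨M, hM⟩ := admissible_bounded hA p₀ p
    exact ⟨M, by rintro _ ⟨f, rfl⟩; exact hM f.1 f.2⟩
  let h : G.Point → ℝ := fun p => ⨆ f : ι, f.1 p
  have hle : ∀ f, Admissible A p₀ f → ∀ p, f p ≤ h p := fun f hf p =>
    le_ciSup (hbdd p) ⟨f, hf⟩
  have happrox : ∀ p, ∀ δ > 0, ∃ f, Admissible A p₀ f ∧ h p - δ < f p := by
    intro p δ hδ
    obtain ⟨f, hf⟩ := exists_lt_of_lt_ciSup (show h p - δ < ⨆ f : ι, f.1 p from by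
      change h p - δ < h p; linarith)
    exact ⟨f.1, f.2, hf⟩
  have hh0 : ∀ p, 0 ≤ h p := hle _ (admissible_zero hA p₀)
  -- the end of an interval without poles
  set Z : Set G.Point := ↑A.support ∪ G.branching with hZ
  have hZfin : Z.Finite := A.support.finite_toSet.union (finite_range _)
  have hZb : G.branching ⊆ Z := subset_union_right
  let r : E × Bool → ℝ → ℝ := fun d s => nextPos Z d s
  have hrs : ∀ d : E × Bool, ∀ s ∈ Ico 0 (G.len d.1), s < r d s ∧ r d s ≤ G.len d.1 :=
    fun d s hs => (isLeast_nextPos hZfin hZb hs).1.1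
  have htan : ∀ f, Admissible A p₀ f → ∀ d : E × Bool, ∀ s ∈ Ico 0 (G.len d.1),
      ∀ u ∈ Ico s (r d s), ∀ y ∈ Icc s (r d s),
        f (G.arc d u) + slp f d u * (y - u) ≤ f (G.arc d y) := by
    intro f hf d s hs u hu y hy
    refine hf.1.tangent_le' hs.1 (hrs d s hs).2 (fun v hv => ?_) hu hy
    have h1 : G.arc d v ∉ Z := notMem_of_lt_nextPos hZfin hZb hs hv
    have h2 : A (G.arc d v) = 0 := by
      by_contra hne
      exact h1 (Or.inl (by simpa using hne))
    simpa [h2] using hf.2.2 (G.arc d v)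
  have hslopes : HasSlopes h := by
    intro d s hs
    obtain ⟨hsr, hrL⟩ := hrs d s hs
    -- `c k` is the largest intercept for which the line of slope `k` stays below `h` on the whole
    -- segment.
    let c : ℤ → ℝ := fun k => ⨅ y : Icc s (r d s), (h (G.arc d y) - k * (y - s))
    have hcb : ∀ k : ℤ, BddBelow (range fun y : Icc s (r d s) =>
        (h (G.arc d y) - k * ((y : ℝ) - s))) := by
      intro k
      refine ⟨-(|(k : ℝ)| * (r d s - s)), ?_⟩
      rintro _ ⟨⟨y, hy⟩, rfl⟩
      have h1 : (k : ℝ) * (y - s) ≤ |(k : ℝ)| * (r d s - s) :=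
        mul_le_mul (le_abs_self _) (by linarith [hy.2]) (by linarith [hy.1]) (abs_nonneg _)
      have := hh0 (G.arc d y)
      simp only
      linarith
    have : Nonempty (Icc s (r d s)) := ⟨⟨s, le_rfl, hsr.le⟩⟩
    refine eventually_affine_of_max (K := Finset.Icc (-deg A) (deg A)) (c := c)
      (φ := fun u => h (G.arc d u)) hsr (fun k _ u hu => ?_) fun u hu => ?_
    · have := ciInf_le (hcb k) ⟨u, hu.1, hu.2.le⟩
      change c k ≤ h (G.arc d u) - k * (u - s) at this
      linarith
    · have key : ∀ δ > 0, ∃ k ∈ Finset.Icc (-deg A) (deg A),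
          h (G.arc d u) - δ ≤ k * (u - s) + c k := by
        intro δ hδ
        obtain ⟨f, hf, hfu⟩ := happrox (G.arc d u) δ hδ
        have huL : u ∈ Ico 0 (G.len d.1) := ⟨hs.1.trans hu.1, hu.2.trans_le hrL⟩
        refine ⟨slp f d u, Finset.mem_Icc.2 ⟨hf.1.neg_le_slp hA hf.2.2 huL,
          hf.1.slp_le hA hf.2.2 huL⟩, ?_⟩
        have : h (G.arc d u) - δ - slp f d u * (u - s) ≤ c (slp f d u) := by
          refine le_ciInf fun y => ?_
          have h1 := htan f hf d s hs u hu y y.2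
          have h2 := hle f hf (G.arc d y)
          linarith
        linarith
      -- The slope in `key` depends on `δ`, but only finitely many slopes occur. So if the best of
      -- these lines missed `h`, taking half of the gap as `δ` would be contradictory.
      by_contra! hcon
      obtain ⟨k, hk, hmax⟩ := Finset.exists_max_image (Finset.Icc (-deg A) (deg A))
        (fun k : ℤ => k * (u - s) + c k) (let ⟨k, hk, _⟩ := key 1 one_pos; ⟨k, hk⟩)
      obtain ⟨l, hl, hl'⟩ := key ((h (G.arc d u) - (k * (u - s) + c k)) / 2)
        (by linarith [hcon k hk])
      have := hmax l hl
      linarith [hcon k hk]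
  refine ⟨h, ⟨hslopes, ?_, fun p => ?_⟩, hle⟩
  · have : ∀ f : ι, f.1 p₀ = 0 := fun f => f.2.2.1
    simp [h, this]
  -- Choose a length `t` on which `h` is linear in all directions at `p`, then an admissible `f`
  -- with `f p > h p - t`. Convexity of `f` gives slopes less than those of `h` plus 1, so by
  -- integrality they do not exceed those of `h`.
  · have hev : ∀ᶠ t in 𝓝[>] (0 : ℝ), ∀ d ∈ tangents p,
        h (G.arc d (coord p d + t)) = h p + slp h d (coord p d) * t ∧
          t < r d (coord p d) - coord p d := by
      rw [Filter.eventually_all_finset]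
      intro d hd
      have h1 := (hslopes.hasSlope (coord_mem hd)).eventually_add
      rw [arc_coord hd] at h1
      refine h1.and ?_
      filter_upwards [Ioo_mem_nhdsGT (sub_pos.2 (hrs d _ (coord_mem hd)).1)] with t ht
      exact ht.2
    obtain ⟨t, ht, ht0⟩ := (hev.and self_mem_nhdsWithin).exists
    have ht0 : 0 < t := ht0
    obtain ⟨f, hf, hfp⟩ := happrox p t ht0
    refine (hf.2.2 p).trans (Finset.sum_le_sum fun d hd => ?_)
    obtain ⟨h1, h2⟩ := ht d hd
    have hI := coord_mem hd
    have h3 := htan f hf d _ hI (coord p d) ⟨le_rfl, (hrs d _ hI).1⟩ (coord p d + t)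
      ⟨by linarith, by linarith⟩
    have h4 := hle f hf (G.arc d (coord p d + t))
    rw [arc_coord hd, add_sub_cancel_left] at h3
    have h5 : (slp f d (coord p d) : ℝ) * t < (slp h d (coord p d) + 1) * t := by linarith
    have h6 := lt_of_mul_lt_mul_right h5 ht0.le
    have h7 : slp f d (coord p d) < slp h d (coord p d) + 1 := by exact_mod_cast h6
    omega

end MetricGraph

namespace MetricGraph

open Filter Topology

variable {V E : Type*} {G : MetricGraph V E}

/-! ### Firing a set of points -/

open Classical in
/-- The profile along a segment of the function obtained by firing a set: `x` and `y` are the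
distances to the ends of the segment, `a` and `b` tell whether these ends belong to the set. -/
def profile (ε : ℝ) (a b : Prop) (x y : ℝ) : ℝ :=
  if a then (if b then ε else max 0 (ε - x)) else if b then max 0 (ε - y) else 0

open Classical in
/-- The slope of `profile` in the direction of increasing `x`. -/
def profileSlope (ε : ℝ) (a b : Prop) (x y : ℝ) : ℤ :=
  -- Slopes are taken to the right: at the break `x = ε` the value is already 0, at `y = ε` already
  -- 1.
  if a then (if b ∨ ε ≤ x then 0 else -1) else if b ∧ y ≤ ε then 1 else 0

lemma profile_swap (ε : ℝ) (a b : Prop) (x y : ℝ) : profile ε a b x y = profile ε b a y x := by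
  unfold profile; split_ifs <;> rfl

/-- The two summands are the opposite slopes at a point inside a segment. Their sum is nonnegative
by convexity of the profile, so firing takes no chips from such points. -/
lemma profileSlope_add_swap (ε : ℝ) (a b : Prop) (x y : ℝ) :
    0 ≤ profileSlope ε a b x y + profileSlope ε b a y x := by
  by_cases ha : a <;> by_cases hb : b <;> simp [profileSlope, ha, hb] <;> split_ifs <;>
    first | omega | (exfalso; linarith)

lemma eventually_profile {ε : ℝ} (a b : Prop) {s n u₀ : ℝ} :
    ∀ᶠ u in 𝓝[>] u₀, profile ε a b (u - s) (n - u) =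
      profile ε a b (u₀ - s) (n - u₀) + profileSlope ε a b (u₀ - s) (n - u₀) * (u - u₀) := by
  by_cases ha : a <;> by_cases hb : b <;> simp only [profile, profileSlope, ha, hb, if_true,
    if_false, true_or, false_or, true_and, false_and]
  · filter_upwards with u; simp
  · by_cases hε : ε ≤ u₀ - s
    · filter_upwards [self_mem_nhdsWithin] with u hu
      have hu : u₀ < u := hu
      rw [max_eq_left (by linarith), max_eq_left (by linarith)]; simp [hε]
    · filter_upwards [Ioo_mem_nhdsGT (show u₀ < s + ε by linarith)] with u hu
      rw [max_eq_right (by linarith [hu.2]), max_eq_right (by linarith)]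
      simp only [hε, if_false]; push_cast; ring
  · by_cases hε : n - u₀ ≤ ε
    · filter_upwards [self_mem_nhdsWithin] with u hu
      have hu : u₀ < u := hu
      rw [max_eq_right (by linarith), max_eq_right (by linarith)]
      simp only [hε, if_true]; push_cast; ring
    · filter_upwards [Ioo_mem_nhdsGT (show u₀ < n - ε by linarith)] with u hu
      rw [max_eq_left (by linarith [hu.2]), max_eq_left (by linarith)]; simp [hε]
  · filter_upwards with u; simp

/-- The interval `[s, n]` of the oriented edge `d` is a segment between consecutive points
of `Z`. -/
structure IsGap (Z : Set G.Point) (d : E × Bool) (s n : ℝ) : Prop where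
  nonneg : 0 ≤ s
  lt : s < n
  le_len : n ≤ G.len d.1
  left_mem : G.arc d s ∈ Z
  right_mem : G.arc d n ∈ Z
  notMem : ∀ u ∈ Ioo s n, G.arc d u ∉ Z

lemma IsGap.flip {Z : Set G.Point} {d : E × Bool} {s n : ℝ} (h : IsGap Z d s n) :
    IsGap Z (flip d) (G.len d.1 - n) (G.len d.1 - s) where
  nonneg := by linarith [h.le_len]
  lt := by linarith [h.lt]
  le_len := by simpa using h.nonneg
  left_mem := by rw [arc_flip, sub_sub_cancel]; exact h.right_mem
  right_mem := by rw [arc_flip, sub_sub_cancel]; exact h.left_mem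
  notMem u hu := by
    rw [arc_flip]; exact h.notMem _ ⟨by linarith [hu.2], by linarith [hu.1]⟩

lemma IsGap.nextPos_eq {Z : Set G.Point} {d : E × Bool} {s n u : ℝ} (h : IsGap Z d s n)
    (hu : u ∈ Ico s n) : nextPos Z d u = n :=
  MetricGraph.nextPos_eq ⟨hu.2, h.le_len⟩ h.right_mem
    fun v hv => h.notMem v ⟨hu.1.trans_lt hv.1, hv.2⟩

/-- The right end is the next point of `Z`; the left end is found by searching along the reversed
edge, unless the given point is itself in `Z`. -/
lemma exists_isGap {Z : Set G.Point} (hfin : Z.Finite) (hZ : G.branching ⊆ Z) {d : E × Bool}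
    {u : ℝ} (hu : u ∈ Ico 0 (G.len d.1)) :
    ∃ s n, IsGap Z d s n ∧ u ∈ Ico s n ∧ (G.arc d u ∈ Z → s = u) := by
  have h1 := isLeast_nextPos hfin hZ hu
  have h2 := fun v hv => notMem_of_lt_nextPos (u := v) hfin hZ hu hv
  set n := nextPos Z d u
  by_cases hmem : G.arc d u ∈ Z
  · exact ⟨u, n, ⟨hu.1, h1.1.1.1, h1.1.1.2, hmem, h1.1.2, h2⟩, ⟨le_rfl, h1.1.1.1⟩, fun _ => rfl⟩
  · have hu0 : 0 < u := by
      refine hu.1.lt_of_ne ?_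
      rintro rfl
      exact hmem (hZ (arc_mem_branching_left d))
    have hI : G.len d.1 - u ∈ Ico 0 (G.len (flip d).1) :=
      ⟨by simpa using hu.2.le, by simpa using hu0⟩
    have h3 := isLeast_nextPos hfin hZ hI
    have h4 := fun v hv => notMem_of_lt_nextPos (u := v) hfin hZ hI hv
    set m := nextPos Z (flip d) (G.len d.1 - u)
    have hm1 : G.len d.1 - u < m := h3.1.1.1
    have hm2 : m ≤ G.len d.1 := h3.1.1.2
    have hm3 : G.arc d (G.len d.1 - m) ∈ Z := by rw [← arc_flip]; exact h3.1.2
    refine ⟨G.len d.1 - m, n, ⟨by linarith, by linarith [h1.1.1.1], h1.1.1.2, hm3, h1.1.2,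
      fun v hv => ?_⟩, ⟨by linarith, h1.1.1.1⟩, fun h => absurd h hmem⟩
    rcases lt_trichotomy v u with h | rfl | h
    · have := h4 (G.len d.1 - v) ⟨by linarith, by linarith [hv.1]⟩
      rwa [arc_flip, sub_sub_cancel] at this
    · exact hmem
    · exact h2 v ⟨h, hv.2⟩

variable [Fintype E]

lemma exists_le_gap {Z : Set G.Point} (hfin : Z.Finite) :
    ∃ ε > 0, ∀ d : E × Bool, ∀ s n, IsGap Z d s n → ε ≤ n - s := by
  have : ∀ᶠ ε in 𝓝[>] (0 : ℝ), ∀ v ∈ hfin.toFinset, ∀ d ∈ (Finset.univ : Finset (E × Bool)),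
      -- The positivity condition discards directions that do not emanate from `v`, for which these
      -- values carry no meaning.
      0 < nextPos Z d (coord v d) - coord v d → ε ≤ nextPos Z d (coord v d) - coord v d := by
    rw [Filter.eventually_all_finset]
    intro v _
    rw [Filter.eventually_all_finset]
    intro d _
    by_cases h : 0 < nextPos Z d (coord v d) - coord v d
    · filter_upwards [Ioo_mem_nhdsGT h] with ε hε _
      exact hε.2.le
    · exact Eventually.of_forall fun ε h' => absurd h' h
  obtain ⟨ε, hε, hε0⟩ := (this.and self_mem_nhdsWithin).exists
  refine ⟨ε, hε0, fun d s n h => ?_⟩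
  have := hε _ (hfin.mem_toFinset.2 h.left_mem) d (Finset.mem_univ d)
  rw [coord_arc ⟨h.nonneg, h.lt.trans_le h.le_len⟩, h.nextPos_eq ⟨le_rfl, h.lt⟩] at this
  exact this (sub_pos.2 h.lt)

open Classical in
/-- The function obtained by firing the subset `W` of `Z`. -/
def firing (Z W : Set G.Point) (ε : ℝ) (x : G.Point) : ℝ :=
  if x ∈ Z then (if x ∈ W then ε else 0)
  else if h : ∃ d, d ∈ tangents x then
    profile ε (next Z x (flip h.choose) ∈ W) (next Z x h.choose ∈ W)
      (nextPos Z (flip h.choose) (coord x (flip h.choose)) - coord x (flip h.choose))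
      (nextPos Z h.choose (coord x h.choose) - coord x h.choose)
  else 0

/-- Inside a gap, `firing` uses an arbitrarily chosen direction; the symmetry `profile_swap` makes
the choice irrelevant. The bound `ε ≤ n - s` lets the profile reach 0 before the other end, so it
agrees with the values on `Z`. -/
lemma firing_arc {Z W : Set G.Point} {ε : ℝ} (hε : 0 < ε) {d : E × Bool} {s n u : ℝ}
    (h : IsGap Z d s n) (hle : ε ≤ n - s) (hu : u ∈ Icc s n) :
    firing Z W ε (G.arc d u) =
      profile ε (G.arc d s ∈ W) (G.arc d n ∈ W) (u - s) (n - u) := by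
  classical
  rcases hu.1.eq_or_lt with rfl | hsu
  · rw [firing, if_pos h.left_mem, sub_self, profile, sub_zero, max_eq_right hε.le,
      max_eq_left (by linarith)]
    split_ifs <;> rfl
  rcases hu.2.eq_or_lt with rfl | hun
  · rw [firing, if_pos h.right_mem, sub_self, profile, sub_zero, max_eq_right hε.le,
      max_eq_left (by linarith)]
    split_ifs <;> rfl
  have hu' : u ∈ Ioo 0 (G.len d.1) := ⟨h.nonneg.trans_lt hsu, hun.trans_le h.le_len⟩
  have hex : ∃ d', d' ∈ tangents (G.arc d u) := ⟨d, arc_mem_tangents ⟨hu'.1.le, hu'.2⟩⟩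
  rw [firing, if_neg (h.notMem u ⟨hsu, hun⟩), dif_pos hex]
  have hflip : G.arc d u = G.arc (flip d) (G.len d.1 - u) := by rw [arc_flip, sub_sub_cancel]
  have hc1 : coord (G.arc d u) d = u := coord_arc ⟨hu'.1.le, hu'.2⟩
  have hc2 : coord (G.arc d u) (flip d) = G.len d.1 - u := by
    rw [hflip]; exact coord_arc ⟨by simpa using hu'.2.le, by simpa using hu'.1⟩
  have hn1 : nextPos Z d u = n := h.nextPos_eq ⟨hsu.le, hun⟩
  have hn2 : nextPos Z (flip d) (G.len d.1 - u) = G.len d.1 - s :=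
    h.flip.nextPos_eq ⟨by linarith, by linarith⟩
  have hs : G.arc (flip d) (G.len d.1 - s) = G.arc d s := by rw [arc_flip, sub_sub_cancel]
  have hchoose := hex.choose_spec
  generalize hex.choose = d' at hchoose ⊢
  rw [tangents_arc hu', Finset.mem_insert, Finset.mem_singleton] at hchoose
  rcases hchoose with hd | hd
  · simp only [hd, next, hc1, hc2, hn1, hn2, hs]
    congr 1
    ring
  · simp only [hd, next, flip_flip, hc1, hc2, hn1, hn2, hs]
    rw [profile_swap]
    congr 1
    ring

lemma hasSlope_firing {Z W : Set G.Point} {ε : ℝ} (hε : 0 < ε) {d : E × Bool} {s n u : ℝ}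
    (h : IsGap Z d s n) (hle : ε ≤ n - s) (hu : u ∈ Ico s n) :
    HasSlope (firing Z W ε) d u
      (profileSlope ε (G.arc d s ∈ W) (G.arc d n ∈ W) (u - s) (n - u)) := by
  filter_upwards [eventually_profile (ε := ε) (s := s) (n := n) (u₀ := u) (G.arc d s ∈ W) (G.arc d n ∈ W),
    Ioo_mem_nhdsGT hu.2] with v hv hvn
  rw [firing_arc hε h hle ⟨hu.1.trans hvn.1.le, hvn.2.le⟩,
    firing_arc hε h hle ⟨hu.1, hu.2.le⟩, hv]

open Classical in
/-- A set of points can be fired so that each of its points loses as many chips as there are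
directions leaving the set, while no other point loses chips. -/
lemma exists_firing {Z : Set G.Point} (hfin : Z.Finite) (hZ : G.branching ⊆ Z) {W : Set G.Point}
    (hW : W ⊆ Z) : ∃ β : G.Point → ℝ, HasSlopes β ∧ (∀ p ∈ W, 0 < β p) ∧
      (∀ p ∈ Z, p ∉ W → β p = 0) ∧ (∀ p, p ∉ W → 0 ≤ ordInt β p) ∧
      ∀ p ∈ W, -(((tangents p).filter fun d => next Z p d ∉ W).card : ℤ) ≤ ordInt β p := by
  obtain ⟨ε, hε, hgap⟩ := exists_le_gap (G := G) hfin
  have hslope : ∀ d : E × Bool, ∀ s n u, IsGap Z d s n → u ∈ Ico s n → HasSlope (firing Z W ε) d u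
      (profileSlope ε (G.arc d s ∈ W) (G.arc d n ∈ W) (u - s) (n - u)) :=
    fun d s n u h hu => hasSlope_firing hε h (hgap d s n h) hu
  have hZslope : ∀ p ∈ Z, ∀ d ∈ tangents p, ∃ y, slp (firing Z W ε) d (coord p d) =
      profileSlope ε (p ∈ W) (next Z p d ∈ W) 0 y := by
    intro p hp d hd
    obtain ⟨s, n, h, hu, hs⟩ := exists_isGap hfin hZ (coord_mem hd)
    rw [arc_coord hd] at hs
    have hs := hs hp
    have h1 := (hslope d s n _ h hu).slp_eq
    rw [← h.nextPos_eq hu, hs, arc_coord hd, sub_self] at h1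
    exact ⟨_, h1⟩
  refine ⟨firing Z W ε, fun d u hu => ?_, fun p hp => ?_, fun p hp hpW => ?_, fun p hp => ?_,
    fun p hp => ?_⟩
  · obtain ⟨s, n, h, hu, -⟩ := exists_isGap hfin hZ hu
    exact ⟨_, hslope d s n u h hu⟩
  · rw [firing, if_pos (hW hp), if_pos hp]; exact hε
  · rw [firing, if_pos hp, if_neg hpW]
  · by_cases hpZ : p ∈ Z
    · refine Finset.sum_nonneg fun d hd => ?_
      obtain ⟨y, hy⟩ := hZslope p hpZ d hd
      rw [hy, profileSlope, if_neg hp]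
      split_ifs <;> simp
    · obtain ⟨d, u, hu, rfl⟩ := exists_arc_of_notMem_branching fun h => hpZ (hZ h)
      obtain ⟨s, n, h, hun, -⟩ := exists_isGap hfin hZ (d := d) ⟨hu.1.le, hu.2⟩
      have hsu : s < u := by
        refine hun.1.lt_of_ne ?_
        rintro rfl
        exact hpZ h.left_mem
      have h2 := hslope (flip d) _ _ (G.len d.1 - u) h.flip
        ⟨by linarith [hun.2], by linarith⟩
      rw [arc_flip, arc_flip, sub_sub_cancel, sub_sub_cancel, sub_sub_sub_cancel_left,
        sub_sub_sub_cancel_left] at h2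
      rw [ordInt_arc _ hu, (hslope d s n u h hun).slp_eq, h2.slp_eq]
      exact profileSlope_add_swap _ _ _ _ _
  · have h1 : ∑ d ∈ tangents p, (if next Z p d ∉ W then (-1 : ℤ) else 0) ≤
        ordInt (firing Z W ε) p := by
      refine Finset.sum_le_sum fun d hd => ?_
      obtain ⟨y, hy⟩ := hZslope p (hW hp) d hd
      rw [hy, profileSlope, if_pos hp]
      split_ifs <;> simp_all
    rw [← Finset.sum_filter, Finset.sum_const, nsmul_eq_mul] at h1
    linarith

/-! ### Burning -/

open Classical in
/-- If one can always find a further point having fewer chips than directions towards the points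
found before, then all points of `Z` can be ordered accordingly. -/
lemma exists_order {Z : Finset G.Point} (C : G.Divisor)
    (H : ∀ l : List G.Point, (∀ p ∈ l, p ∈ Z) → (∃ p ∈ Z, p ∉ l) → ∃ v ∈ Z, v ∉ l ∧
      C v ≤ (((tangents v).filter fun d => next ↑Z v d ∈ l).card : ℤ) - 1) :
    ∃ l : List G.Point, l.Nodup ∧ (∀ p, p ∈ l ↔ p ∈ Z) ∧ ∀ v ∈ l,
      C v ≤ (((tangents v).filter fun d => Precedes l (next ↑Z v d) v).card : ℤ) - 1 := by
  have key : ∀ n ≤ Z.card, ∃ l : List G.Point, l.Nodup ∧ l.length = n ∧ (∀ p ∈ l, p ∈ Z) ∧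
      ∀ v ∈ l, C v ≤
        (((tangents v).filter fun d => Precedes l (next ↑Z v d) v).card : ℤ) - 1 := by
    intro n hn
    induction n with
    | zero => exact ⟨[], by simp⟩
    | succ n ih =>
      obtain ⟨l, hnd, hlen, hsub, hl⟩ := ih (by omega)
      obtain ⟨v, hvZ, hvl, hv⟩ := H l hsub (by
        by_contra! hcon
        have h1 : Z ⊆ l.toFinset := fun p hp => List.mem_toFinset.2 (hcon p hp)
        have h2 := Finset.card_le_card h1
        have h3 := l.toFinset_card_le
        omega)
      refine ⟨l ++ [v], ?_, by simp [hlen], ?_, ?_⟩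
      · rw [List.nodup_append]
        refine ⟨hnd, by simp, ?_⟩
        rintro a ha b hb rfl
        rw [List.mem_singleton] at hb
        exact hvl (hb ▸ ha)
      · intro p hp
        rcases List.mem_append.1 hp with h | h
        · exact hsub p h
        · rw [List.mem_singleton.1 h]; exact hvZ
      · intro w hw
        rcases List.mem_append.1 hw with h | h
        · refine (hl w h).trans (sub_le_sub_right (Nat.cast_le.2 (Finset.card_le_card ?_)) _)
          refine Finset.monotone_filter_right _ fun d _ hd => ?_
          have hd : l.idxOf (next ↑Z w d) < l.idxOf w := hd
          -- A missing point has index `l.length`, so preceding a member of `l` forces membership,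
          -- and the indices survive appending `v`.
          have hmem : next ↑Z w d ∈ l :=
            List.idxOf_lt_length_iff.1 (hd.trans (List.idxOf_lt_length_iff.2 h))
          change (l ++ [v]).idxOf _ < (l ++ [v]).idxOf _
          rwa [List.idxOf_append_of_mem hmem, List.idxOf_append_of_mem h]
        · rw [List.mem_singleton.1 h]
          refine hv.trans (sub_le_sub_right (Nat.cast_le.2 (Finset.card_le_card ?_)) _)
          refine Finset.monotone_filter_right _ fun d _ hd => ?_
          change (l ++ [v]).idxOf _ < (l ++ [v]).idxOf _
          rw [List.idxOf_append_of_mem hd, List.idxOf_append_of_notMem hvl]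
          exact (List.idxOf_lt_length_iff.2 hd).trans_le (Nat.le_add_right _ _)
  obtain ⟨l, hnd, hlen, hsub, hl⟩ := key Z.card le_rfl
  refine ⟨l, hnd, fun p => ⟨hsub p, fun hp => ?_⟩, hl⟩
  have h1 : l.toFinset ⊆ Z := fun p hp => hsub p (List.mem_toFinset.1 hp)
  have h2 : l.toFinset = Z :=
    Finset.eq_of_subset_of_card_le h1 (by rw [List.toFinset_card_of_nodup hnd, hlen])
  rw [← List.mem_toFinset, h2]; exact hp

variable [Fintype V]

/-- A divisor which is not equivalent to an effective one has an equivalent divisor, negative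
somewhere, from whose negative points a fire spreads to any finite set of points. -/
lemma exists_equiv_burning {C : G.Divisor} (hC : linearSystem C = ∅) :
    ∃ C' : G.Divisor, LinEquiv C' C ∧ ∀ Z U : Set G.Point, Z.Finite → G.branching ⊆ Z →
      (∀ p, C' p < 0 → p ∈ Z ∧ p ∈ U) → (∃ p ∈ Z, p ∉ U) → ∃ v ∈ Z, v ∉ U ∧
        C' v < {d | d ∈ tangents v ∧ next Z v d ∈ U}.ncard := by
  classical
  let debt : G.Divisor → ℤ := fun D => deg (posPart (-D))
  have hdebt : ∀ D, 0 ≤ debt D := fun D => deg_nonneg (posPart_nonneg _)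
  obtain ⟨C₀, hC₀, hmin⟩ := WellFounded.has_min (measure fun D : G.Divisor => (debt D).toNat).wf
    {D | LinEquiv D C} ⟨C, LinEquiv.refl C⟩
  have hmin : ∀ D, LinEquiv D C → debt C₀ ≤ debt D := by
    intro D hD
    have h1 : ¬(debt D).toNat < (debt C₀).toNat := hmin D hD
    have h2 := hdebt D
    have h3 := hdebt C₀
    omega
  obtain ⟨p₀, hp₀⟩ : ∃ p, C₀ p < 0 := by
    by_contra! hcon
    have : C₀ ∈ linearSystem C := ⟨hcon, hC₀⟩
    rw [hC] at this
    exact this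
  have hA : 0 ≤ posPart C₀ := posPart_nonneg C₀
  obtain ⟨h, hh, hlargest⟩ := exists_largest_admissible hA p₀
  obtain ⟨C', hC', hC'h⟩ := hh.1.exists_linEquiv C₀
  have hC'C := hC'.trans hC₀
  refine ⟨C', hC'C, fun Z U hfin hZ hneg hU => ?_⟩
  have hge : ∀ p, min (C₀ p) 0 ≤ C' p := by
    intro p
    have := hh.2.2 p
    rw [posPart_apply] at this
    rw [hC'h]
    omega
  -- The debt of `C'` is pointwise at most that of `C₀`, and in total at least as large by
  -- minimality; so the two agree at `p₀`.
  have hC'p₀ : C' p₀ < 0 := by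
    have h1 : posPart (-C') ≤ posPart (-C₀) := by
      intro p
      have := hge p
      simp only [posPart_apply, Finsupp.neg_apply]
      omega
    have h2 := le_deg (sub_nonneg.2 h1) p₀
    rw [deg_sub] at h2
    have h3 : debt C₀ ≤ debt C' := hmin C' hC'C
    simp only [debt] at h3
    simp only [Finsupp.sub_apply, posPart_apply, Finsupp.neg_apply] at h2
    omega
  by_contra! hcon
  obtain ⟨v, hvZ, hvU⟩ := hU
  -- Fire the unburnt points. Each has at least as many chips in `C' = C₀ + D_h` as directions
  -- leaving the set, so `h + β` still has poles bounded by the positive part of `C₀`. It vanishes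
  -- at the burnt point `p₀` but exceeds `h` at `v`.
  obtain ⟨β, hβ, hβpos, hβzero, hβord, hβW⟩ := exists_firing hfin hZ
    (W := Z \ U) sdiff_subset
  have hadm : Admissible (posPart C₀) p₀ (h + β) := by
    refine ⟨hh.1.add hβ, ?_, fun p => ?_⟩
    · rw [Pi.add_apply, hh.2.1, hβzero p₀ (hneg p₀ hC'p₀).1 fun h => h.2 (hneg p₀ hC'p₀).2,
        add_zero]
    · rw [ordInt_add hh.1 hβ]
      by_cases hp : p ∈ Z \ U
      · have h1 : -(((tangents p).filter fun d => next Z p d ∉ Z \ U).card : ℤ) ≤ ordInt β p := by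
          convert hβW p hp
        have h2 := hcon p hp.1 hp.2
        have h3 : {d | d ∈ tangents p ∧ next Z p d ∈ U} =
            ↑((tangents p).filter fun d => next Z p d ∉ Z \ U) := by
          ext d
          simp only [mem_ofPred_eq, Finset.coe_filter]
          refine and_congr_right fun hd => ?_
          simp [next_mem hfin hZ hd]
        rw [h3, Set.ncard_coe_finset, hC'h] at h2
        rw [posPart_apply]
        omega
      · linarith [hh.2.2 p, hβord p hp]
  have h1 := hlargest _ hadm v
  have h2 := hβpos v ⟨hvZ, hvU⟩
  rw [Pi.add_apply] at h1
  linarith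

/-- A divisor which is not equivalent to an effective one is equivalent to a divisor dominated by
the divisor of a permutation. -/
lemma exists_equiv_le_nu {I : Set G.Point} (hI : I.Finite) {C : G.Divisor}
    (hC : linearSystem C = ∅) :
    ∃ C' P, LinEquiv C' C ∧ G.IsPermutation I P ∧ C' ≤ nu P := by
  classical
  obtain ⟨C', hC', hburn⟩ := exists_equiv_burning hC
  have hfin : (G.branching ∪ I ∪ ↑C'.support).Finite :=
    ((finite_range _).union hI).union C'.support.finite_toSet
  set Z := hfin.toFinset with hZdef
  have hZ : (Z : Set G.Point) = G.branching ∪ I ∪ ↑C'.support := hfin.coe_toFinset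
  have hZb : G.branching ⊆ ↑Z := hZ ▸ subset_union_left.trans subset_union_left
  have hsupp : ∀ p, C' p ≠ 0 → p ∈ Z := fun p hp => by
    rw [← Finset.mem_coe, hZ]; exact Or.inr (by simpa using hp)
  obtain ⟨P, hnd, hPZ, hP⟩ := exists_order (Z := Z) C' (by
    intro l _ hl
    -- Points in debt are listed first: for them the inequality holds with no direction counted,
    -- since the coefficient is at most -1. After that the fire supplies the next point.
    by_cases hneg : ∀ p, C' p < 0 → p ∈ l
    · obtain ⟨v, hv, hvl, h⟩ := hburn ↑Z {p | p ∈ l} Z.finite_toSet hZb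
        (fun p hp => ⟨hsupp p hp.ne, hneg p hp⟩) hl
      refine ⟨v, hv, hvl, ?_⟩
      have h1 : {d | d ∈ tangents v ∧ next ↑Z v d ∈ {p | p ∈ l}} =
          ↑((tangents v).filter fun d => next ↑Z v d ∈ l) := by ext d; simp
      rw [h1, Set.ncard_coe_finset] at h
      omega
    · push Not at hneg
      obtain ⟨v, hv, hvl⟩ := hneg
      exact ⟨v, hsupp v hv.ne, hvl, by omega⟩)
  have hPset : {p | p ∈ P} = (Z : Set G.Point) := by ext p; simpa using hPZ p
  have hperm : G.branching ∪ I ⊆ {p | p ∈ P} := by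
    rw [hPset, hZ]; exact subset_union_left
  refine ⟨C', P, hC', ⟨hnd, hperm⟩, fun v => ?_⟩
  by_cases hv : v ∈ P
  · rw [nu_apply (subset_union_left.trans hperm) hv, hPset]
    exact hP v hv
  · rw [nu_apply_of_notMem hv]
    by_contra! hne
    exact hv ((hPZ v).2 (hsupp v hne.ne'))

/-! ### The rank -/

/-- The divisors dominated by the divisor of a permutation have empty linear systems. -/
lemma linearSystem_eq_empty {P : List G.Point} (hP : G.branching ⊆ {p | p ∈ P}) {D : G.Divisor}
    (h : D ≤ nu P) : linearSystem D = ∅ := by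
  rw [eq_empty_iff_forall_notMem]
  rintro F ⟨hF, hFD⟩
  obtain ⟨f, hf, hfF⟩ := linEquiv_iff.1 hFD
  obtain ⟨p, hp⟩ := exists_nu_add_ordInt_neg hP hf
  have h1 : 0 ≤ F p := hF p
  have h2 : D p ≤ nu P p := h p
  have h3 := hfF p
  omega

/-- Subtracting the positive part of `D' - nu P` from `D'` leaves a divisor dominated by `nu P`, and
emptiness of the linear system is invariant under equivalence. -/
lemma degPos_sub_nu_mem_rankSet {P : List G.Point} (hP : G.branching ⊆ {p | p ∈ P})
    {D D' : G.Divisor} (h : LinEquiv D' D) : degPos (D' - nu P) - 1 ∈ rankSet D := by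
  refine ⟨posPart (D' - nu P), posPart_nonneg _, ?_, by rw [deg_posPart]⟩
  have h1 : linearSystem (D' - posPart (D' - nu P)) = ∅ := by
    refine linearSystem_eq_empty hP fun p => ?_
    simp only [Finsupp.sub_apply, posPart_apply]
    omega
  rw [eq_empty_iff_forall_notMem] at h1 ⊢
  rintro F ⟨hF, hFD⟩
  refine h1 F ⟨hF, hFD.trans ?_⟩
  have := h.symm.add_right (-posPart (D' - nu P))
  rwa [← sub_eq_add_neg, ← sub_eq_add_neg] at this

omit [Fintype E] in
lemma exists_isPermutation {I : Set G.Point} (hI : I.Finite) : ∃ P, G.IsPermutation I P := by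
  have hfin : (G.branching ∪ I).Finite := (finite_range _).union hI
  refine ⟨hfin.toFinset.toList, Finset.nodup_toList _, fun p hp => ?_⟩
  simpa using hp

omit [Fintype V] in
lemma IsLoopTransversal.finite {I : Set G.Point} (hI : G.IsLoopTransversal I) : I.Finite := by
  obtain ⟨t, -, rfl⟩ := hI
  refine (finite_range fun e => G.pt e (t e)).subset ?_
  rintro _ ⟨e, -, rfl⟩
  exact ⟨e, rfl⟩

/-- Any ordering of the vertices exhibits an element of `rankSet D`, and effective divisors have
nonnegative degree, so the infimum of integers is attained. -/
lemma isLeast_rank (D : G.Divisor) : IsLeast (rankSet D) (rank D) := by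
  obtain ⟨P, hP⟩ := exists_isPermutation (G := G) finite_empty
  have hne : (rankSet D).Nonempty :=
    ⟨_, degPos_sub_nu_mem_rankSet (subset_union_left.trans hP.2) (LinEquiv.refl D)⟩
  have hbdd : BddBelow (rankSet D) := by
    refine ⟨-1, ?_⟩
    rintro _ ⟨F, hF, -, rfl⟩
    linarith [deg_nonneg hF]
  exact ⟨Int.csInf_mem hne hbdd, fun n hn => csInf_le hbdd hn⟩

end MetricGraph

end

theorem mainTheorem5 {V E : Type*} [Fintype V] [Fintype E] (G : MetricGraph V E)
    (I : Set G.Point) (hI : G.IsLoopTransversal I) (D : G.Divisor) :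
    IsLeast (MetricGraph.rankSet D) (MetricGraph.rank D) ∧
    IsLeast {n : ℤ | ∃ (D' : G.Divisor) (P : List G.Point),
        MetricGraph.LinEquiv D' D ∧ G.IsPermutation I P ∧
          n = MetricGraph.degPos (D' - MetricGraph.nu P) - 1}
      (MetricGraph.rank D) := by
  have hrank := MetricGraph.isLeast_rank D
  have hlower : ∀ (D' : G.Divisor) (P : List G.Point), MetricGraph.LinEquiv D' D →
      G.IsPermutation I P → MetricGraph.rank D ≤
        MetricGraph.degPos (D' - MetricGraph.nu P) - 1 := fun D' P hD' hP =>
    hrank.2 (MetricGraph.degPos_sub_nu_mem_rankSet (subset_union_left.trans hP.2) hD')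
  refine ⟨hrank, ?_, ?_⟩
  · obtain ⟨F, hF, hempty, hdeg⟩ := hrank.1
    obtain ⟨C, P, hC, hP, hle⟩ := MetricGraph.exists_equiv_le_nu hI.finite hempty
    have hD' : MetricGraph.LinEquiv (C + F) D := by
      simpa using hC.add_right F
    -- Adding `F` back to `C ~ D - F` gives a divisor equivalent to `D`. As `C ≤ nu P` and `F ≥ 0`,
    -- the positive part of `C + F - nu P` is at most `F`, whose degree is the rank plus 1.
    refine ⟨C + F, P, hD', hP, le_antisymm (hlower _ P hD' hP) ?_⟩
    have : MetricGraph.posPart (C + F - MetricGraph.nu P) ≤ F := by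
      intro p
      have h1 : C p ≤ MetricGraph.nu P p := hle p
      have h2 : 0 ≤ F p := hF p
      simp only [MetricGraph.posPart_apply, Finsupp.sub_apply, Finsupp.add_apply]
      omega
    have := MetricGraph.deg_mono this
    rw [MetricGraph.deg_posPart] at this
    rw [hdeg]
    linarith
  · rintro _ ⟨D', P, hD', hP, rfl⟩
    exact hlower D' P hD' hP
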